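/- **Theorem (uniqueness of the Perron–Frobenius eigenvector).** Let $\mathscr P=\{\mathscr P_{n,\pm}\}_{n\ge 0}$ be a $C^*$-planar algebra, that is, a shaded planar algebra over $\mathbb C$ in the sense of Jones whose box spaces $\mathscr P_{n,\pm}$ are finite-dimensional $C^*$-algebras, with multiplication given by vertical composition and involution compatible with the reflection of tangles in a horizontal line, together with linear functionals $tr_{0,\pm}$ on $\mathscr P_{0,\pm}$ such that, for all $n$, the functional $tr_{n,\pm}(x)=tr_{0,\pm}(\text{the closure of all strings of }x\text{ on the right})$ is a faithful positive trace on $\mathscr P_{n,\pm}$. Fix a sign $\pm$ and $x\in\mathscr P_{2,\pm}$. Let $\widehat x\in\mathscr P_{2,\mp}$ be the Fourier transform of $x$, i.e. its clockwise rotation by $90^\circ$. For $y\in\mathscr P_{1,\pm}$ and $w\in\mathscr P_{2,\mp}$ let $y*w\in\mathscr P_{1,\pm}$ be the convolution, obtained by placing $y$ on the left of $w$ and joining the string of $y$, at the top and at the bottom, with the left string of $w$. An element $a$ of a $C^*$-algebra is called positive if $a=bb^*$ for some $b$, and strictly positive if it is positive and invertible; $a\le b$ means that $b-a$ is positive. Suppose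 that * $x$ is $\mathfrak F$-positive, i.e. $\widehat x$ is positive in $\mathscr P_{2,\mp}$, and * $x$ is irreducible on $\mathscr P_{1,\pm}$, i.e. whenever a projection $p\in\mathscr P_{1,\pm}$ satisfies $p*\widehat x\le\lambda p$ for some real $\lambda>0$, then $p=0$ or $p=I$. Let $r$ be the spectral radius of $x$ in the algebra $\mathscr P_{2,\pm}$. Then there exists a strictly positive element $y\in\mathscr P_{1,\pm}$ with $$y*\widehat x=r\,y ,$$ and it is unique up to a scalar: every strictly positive $y_1\in\mathscr P_{1,\pm}$ with $y_1*\widehat x=r\,y_1$ is of the form $y_1=cy$ with $c>0$. Moreover, every (not necessarily positive) element $y'\in\mathscr P_{1,\pm}$ with $y'*\widehat x=r\,y'$ is a complex multiple of $y$. -/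

import Mathlib

universe u

namespace PlanarAlg

/-! ### Planar tangles

Shadings are booleans: `true` is `+` (the region at the distinguished boundary interval is
unshaded) and `false` is `-` (it is shaded). A family of box spaces is a family
`P : ℕ → Bool → Type u`, where `P n s` stands for the space of `n`-boxes of sign `s`; an
`n`-box has `n` strings at the bottom and `n` strings at the top, and its distinguished
interval (the dollar sign) is on the left.

A planar tangle, with its internal discs filled by elements of the box spaces, is written in
Morse position: it is cut by horizontal lines into slices, each of which contains exactly one
local minimum of a string, one local maximum of a string, or one box, all other strings being
vertical. Every planar tangle is isotopic to one of this form. -/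

/-- The only non-vertical part of a slice. -/
inductive Piece (P : ℕ → Bool → Type u) : Type u
  /-- a local minimum of a string: two new strings start here -/
  | cup : Piece P
  /-- a local maximum of a string: two neighbouring strings are joined -/
  | cap : Piece P
  /-- an internal disc with `2 * k` boundary points and sign `ε`, filled with `x`,
  its dollar sign on the left -/
  | box (k : ℕ) (ε : Bool) (x : P k ε) : Piece P

namespace Piece

variable {P : ℕ → Bool → Type u}

/-- The number of strings that meet the piece from below. -/
def bot : Piece P → ℕ
  | cup => 0
  | cap => 2
  | box k _ _ => k

/-- The number of strings that leave the piece at its top. -/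
def top : Piece P → ℕ
  | cup => 2
  | cap => 0
  | box k _ _ => k

/-- The sign `s` of the region on the left of the piece must be that of the disc. -/
def Fits (s : Bool) : Piece P → Prop
  | cup => True
  | cap => True
  | box _ ε _ => ε = s

end Piece

/-- A slice: `pos` vertical strings, then a piece, then further vertical strings. -/
structure Slice (P : ℕ → Bool → Type u) : Type u where
  pos : ℕ
  piece : Piece P

/-- A diagram is a list of slices, read from the bottom to the top. -/
abbrev Diagram (P : ℕ → Bool → Type u) : Type u := List (Slice P)

/-- The sign of the region to the right of the first `i` strings, if that of the leftmost
region is `s`: the shading changes at every string. -/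
def shadeAt (s : Bool) (i : ℕ) : Bool := xor s i.bodd

/-- The diagram `D`, drawn in a rectangle whose left side lies in a region of sign `s`, is a
tangle with `n` strings at the bottom and `m` strings at the top. -/
def IsTangle {P : ℕ → Bool → Type u} (s : Bool) : ℕ → Diagram P → ℕ → Prop
  | n, [], m => n = m
  | n, a :: D, m =>
      a.pos + a.piece.bot ≤ n ∧ a.piece.Fits (shadeAt s a.pos) ∧
        IsTangle s (n - a.piece.bot + a.piece.top) D m

section Diagrams

variable {P : ℕ → Bool → Type u}

/-- The diagram moved to the right of `i` vertical strings. -/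
def shift (i : ℕ) (D : Diagram P) : Diagram P :=
  D.map fun a => ⟨i + a.pos, a.piece⟩

/-- `k` nested minima; they create the strings at the positions `i, …, i + 2 * k - 1`. -/
def cups (i k : ℕ) : Diagram P :=
  (List.range k).map fun j => ⟨i + j, Piece.cup⟩

/-- `k` nested maxima; they close the strings at the positions `i, …, i + 2 * k - 1`. -/
def caps (i k : ℕ) : Diagram P :=
  (List.range k).reverse.map fun j => ⟨i + j, Piece.cap⟩

/-- A diagram `D` on `k` strings (a function of its horizontal position) turned by `180`
degrees clockwise: its bottom strings are bent upwards on its left, and its top strings are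
bent downwards on its right. -/
def halfTurn (k : ℕ) (D : ℕ → Diagram P) (i : ℕ) : Diagram P :=
  cups i k ++ D (i + k) ++ caps (i + k) k

/-- A box turned by `360` degrees. -/
def fullTurn (k : ℕ) (ε : Bool) (x : P k ε) : ℕ → Diagram P :=
  halfTurn k (halfTurn k fun j => [⟨j, Piece.box k ε x⟩])

/-- The elementary planar isotopies. -/
inductive Move : Diagram P → Diagram P → Prop
  /-- two pieces that lie side by side change their heights -/
  | exchange (i t : ℕ) (a b : Piece P) :
      Move [⟨i, a⟩, ⟨i + a.top + t, b⟩] [⟨i + a.bot + t, b⟩, ⟨i, a⟩]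
  /-- a string is pulled straight -/
  | zigzag_left (i : ℕ) : Move [⟨i, Piece.cup⟩, ⟨i + 1, Piece.cap⟩] []
  /-- a string is pulled straight -/
  | zigzag_right (i : ℕ) : Move [⟨i + 1, Piece.cup⟩, ⟨i, Piece.cap⟩] []
  /-- an internal disc is turned once around itself -/
  | turn (i k : ℕ) (ε : Bool) (x : P k ε) : Move (fullTurn k ε x i) [⟨i, Piece.box k ε x⟩]

/-- The diagram that closes the `n` strings of `x` on the right. -/
def closeRight {n : ℕ} {s : Bool} (x : P n s) : Diagram P :=
  cups 0 n ++ [⟨0, Piece.box n s x⟩] ++ caps 0 n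

/-- The mirror image of a piece in a horizontal line; the contents are replaced by adjoints. -/
def Piece.reflect [∀ n s, Star (P n s)] : Piece P → Piece P
  | .cup => .cap
  | .cap => .cup
  | .box k ε x => .box k ε (star x)

/-- The mirror image of a diagram in a horizontal line; the contents are replaced by
adjoints. -/
def reflect [∀ n s, Star (P n s)] (D : Diagram P) : Diagram P :=
  D.reverse.map fun a => ⟨a.pos, a.piece.reflect⟩

end Diagrams

/-! ### Planar algebras -/

/-- A (shaded) planar algebra over `ℂ` with box spaces `P n s`: an action of planar tangles.
`Z n s D` is the result of the action of the tangle underlying `D` on the elements that fill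
its internal discs; only its values on diagrams with `IsTangle s n D n` are meaningful. -/
structure PlanarAlgebra (P : ℕ → Bool → Type u)
    [∀ n s, AddCommGroup (P n s)] [∀ n s, Module ℂ (P n s)] where
  Z : ∀ (n : ℕ) (s : Bool), Diagram P → P n s
  /-- Isotopic tangles act in the same way. -/
  isotopy : ∀ (n : ℕ) (s : Bool) (C A B D : Diagram P), Move A B →
    IsTangle s n (C ++ A ++ D) n → IsTangle s n (C ++ B ++ D) n →
    Z n s (C ++ A ++ D) = Z n s (C ++ B ++ D)
  /-- The tangle with vertical strings and one internal disc acts as the identity. -/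
  identity : ∀ (n : ℕ) (s : Bool) (x : P n s), Z n s [⟨0, Piece.box n s x⟩] = x
  /-- The action is linear in the contents of every internal disc. -/
  multilinear : ∀ (n : ℕ) (s : Bool) (C D : Diagram P) (i k : ℕ) (ε : Bool) (c : ℂ)
    (x y : P k ε), IsTangle s n (C ++ [⟨i, Piece.box k ε x⟩] ++ D) n →
    Z n s (C ++ [⟨i, Piece.box k ε (c • x + y)⟩] ++ D) =
      c • Z n s (C ++ [⟨i, Piece.box k ε x⟩] ++ D) + Z n s (C ++ [⟨i, Piece.box k ε y⟩] ++ D)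
  /-- Gluing a tangle into an internal disc corresponds to composing the actions. -/
  gluing : ∀ (n : ℕ) (s : Bool) (C D E : Diagram P) (i k : ℕ) (ε : Bool),
    IsTangle ε k E k → IsTangle s n (C ++ [⟨i, Piece.box k ε (Z k ε E)⟩] ++ D) n →
    Z n s (C ++ [⟨i, Piece.box k ε (Z k ε E)⟩] ++ D) = Z n s (C ++ shift i E ++ D)

/-- A `C*`-planar algebra: a planar algebra whose box spaces are finite-dimensional
`C*`-algebras, with multiplication given by vertical composition (`x * y` has `x` below `y`)
and involution compatible with the reflection of tangles, together with functionals on the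
`0`-box spaces such that closing all strings on the right defines faithful positive traces on
all box spaces. -/
structure CStarPlanarAlgebra (P : ℕ → Bool → Type u) [∀ n s, CStarAlgebra (P n s)]
    extends PlanarAlgebra P where
  finiteDimensional : ∀ (n : ℕ) (s : Bool), FiniteDimensional ℂ (P n s)
  Z_one : ∀ (n : ℕ) (s : Bool), Z n s [] = 1
  Z_mul : ∀ (n : ℕ) (s : Bool) (x y : P n s),
    Z n s [⟨0, Piece.box n s x⟩, ⟨0, Piece.box n s y⟩] = x * y
  Z_star : ∀ (n : ℕ) (s : Bool) (D : Diagram P), IsTangle s n D n →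
    star (Z n s D) = Z n s (reflect D)
  tr₀ : ∀ s : Bool, P 0 s →ₗ[ℂ] ℂ
  trace_pos : ∀ (n : ℕ) (s : Bool) (x : P n s), x ≠ 0 →
    ∃ t : ℝ, 0 < t ∧ tr₀ s (Z 0 s (closeRight (star x * x))) = (t : ℂ)

/-- Positive elements of a `C*`-algebra. -/
def IsPositive {A : Type*} [CStarAlgebra A] (a : A) : Prop := ∃ b : A, a = b * star b

/-- Strictly positive elements: positive and invertible. -/
def IsStrictlyPositiveElt {A : Type*} [CStarAlgebra A] (a : A) : Prop :=
  IsPositive a ∧ IsUnit a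

namespace CStarPlanarAlgebra

variable {P : ℕ → Bool → Type u} [∀ n s, CStarAlgebra (P n s)]

/-- The Fourier transform of a `2`-box: the clockwise rotation by `90` degrees. The bottom left
string of `x` is bent upwards on the left, its top right string downwards on the right. -/
def fourier (PA : CStarPlanarAlgebra P) {s : Bool} (x : P 2 s) : P 2 (!s) :=
  PA.Z 2 (!s) [⟨0, Piece.cup⟩, ⟨1, Piece.box 2 s x⟩, ⟨2, Piece.cap⟩]

/-- The convolution `y * w` of a `1`-box `y` with a `2`-box `w`: the box `y` stands on the left
of `w`, and its string is joined, at both ends, with the left string of `w`. -/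
def conv (PA : CStarPlanarAlgebra P) {s : Bool} (y : P 1 s) (w : P 2 (!s)) : P 1 s :=
  PA.Z 1 s [⟨0, Piece.cup⟩, ⟨0, Piece.box 1 s y⟩, ⟨1, Piece.box 2 (!s) w⟩, ⟨0, Piece.cap⟩]

/-- `x` is `𝔉`-positive: its Fourier transform is positive. -/
def FPositive (PA : CStarPlanarAlgebra P) {s : Bool} (x : P 2 s) : Prop :=
  IsPositive (PA.fourier x)

/-- `x` is irreducible on the `1`-box space of the same sign: if a projection `p` there
satisfies `p * 𝔉(x) ≤ c p` for some `c > 0`, then `p` is `0` or `1`. -/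
def Irreducible (PA : CStarPlanarAlgebra P) {s : Bool} (x : P 2 s) : Prop :=
  ∀ p : P 1 s, IsStarProjection p → ∀ c : ℝ, 0 < c →
    IsPositive ((c : ℂ) • p - PA.conv p (PA.fourier x)) → p = 0 ∨ p = 1

/-- `y * 𝔉(x) = r y`, where `r` is the spectral radius of `x` in the algebra of `2`-boxes. -/
def IsPFEigenvector (PA : CStarPlanarAlgebra P) {s : Bool} (x : P 2 s) (y : P 1 s) : Prop :=
  PA.conv y (PA.fourier x) = ((spectralRadius ℂ x).toReal : ℂ) • y

end CStarPlanarAlgebra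

end PlanarAlg

/-! Convolution by the Fourier transform of `x` is a positive linear map `T` on the `1`-boxes, and
irreducibility says that `T` leaves no proper face of the positive cone invariant. Perron–Frobenius
theory on a finite-dimensional `C*`-algebra then gives a strictly positive eigenvector and its
uniqueness (`IrreduciblePositive.exists_eigenvector`, `IrreduciblePositive.exists_eq_smul`). Two
points depend on planar algebra.

Positivity of `T`: for `y = b* b` and `w = c* c`, the diagram of `y * w` is a diagram `D` above its
own mirror image, where `D` loses two strings on its way up (`reflect_append_nonneg`). A cup on top
of `D` makes it an element `W` of a box algebra, and the trace of `W* W` is that of the mirrored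
diagram times a circle. The circle is neither a scalar nor known to be invertible, but a `0`-box
that it annihilates vanishes beside a string, so a generalized inverse root removes it. Applied to
all conjugates, the trace inequality yields positivity.

The eigenvalue: adding a vertical string intertwines `T` with a convolution on `2`-boxes, which the
Fourier transform identifies with right multiplication by `x`. Strict positivity of the eigenvector
survives, and the eigenvalue of such a vector dominates all others, so it is the spectral radius
(`conv_eq_spectralRadius_smul`). -/

namespace PlanarAlg
variable {P : ℕ → Bool → Type u}

/-! ### String counts and shadings of diagrams. -/

theorem isTangle_append {s : Bool} {A B : Diagram P} {n m : ℕ} :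
    IsTangle s n (A ++ B) m ↔ ∃ k, IsTangle s n A k ∧ IsTangle s k B m := by
  induction A generalizing n with
  | nil => simp [IsTangle]
  | cons a A ih =>
    simp only [List.cons_append, IsTangle, ih]
    constructor
    · rintro ⟨h1, h2, k, h3, h4⟩; exact ⟨k, ⟨h1, h2, h3⟩, h4⟩
    · rintro ⟨k, ⟨h1, h2, h3⟩, h4⟩; exact ⟨h1, h2, k, h3, h4⟩

theorem reflect_append [∀ n s, Star (P n s)] (A B : Diagram P) :
    reflect (A ++ B) = reflect B ++ reflect A := by
  simp [reflect]

theorem reflect_reflect [∀ n s, InvolutiveStar (P n s)] (A : Diagram P) :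
    reflect (reflect A) = A := by
  have : ∀ p : Piece P, p.reflect.reflect = p := by
    intro p; cases p <;> simp [Piece.reflect]
  simp [reflect, Function.comp_def, this]

theorem isTangle_reflect [∀ n s, Star (P n s)] {s : Bool} {D : Diagram P} {n m : ℕ} 
   (h : IsTangle s n D m) : IsTangle s m (reflect D) n := by
  induction D generalizing n with
  | nil => exact h.symm
  | cons a D ih =>
    obtain ⟨h1, h2, h3⟩ := h
    change IsTangle s m (reflect ([a] ++ D)) n
    rw [reflect_append]
    refine isTangle_append.2 ⟨_, ih h3, ?_⟩
    obtain ⟨i, p⟩ := a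
    cases p <;> simp_all [reflect, IsTangle, Piece.reflect, Piece.bot, Piece.top, Piece.Fits] <;> omega

theorem isTangle_box {s : Bool} {n i k : ℕ} {ε : Bool} (x : P k ε) (h : i + k ≤ n)
    (hε : ε = shadeAt s i) : IsTangle s n [⟨i, Piece.box k ε x⟩] n := by
  simp [IsTangle, Piece.bot, Piece.top, Piece.Fits, hε]; omega

theorem isTangle_cups (s : Bool) (n m : ℕ) : IsTangle s m (cups 0 n : Diagram P) (m+2*n) := by
  induction n with
  | zero => simp [cups, IsTangle]
  | succ n ih =>
    have : (cups 0 (n+1) : Diagram P) = cups 0 n ++ [⟨n, Piece.cup⟩] := by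
      simp [cups, List.range_succ]
    rw [this]
    refine isTangle_append.2 ⟨_, ih, ?_⟩
    simp [IsTangle, Piece.bot, Piece.top, Piece.Fits]; omega

theorem reflect_cups [∀ n s, Star (P n s)] (n i : ℕ) : reflect (cups i n : Diagram P) = caps i n := by
  simp [reflect, cups, caps, Piece.reflect, List.map_reverse]

theorem isTangle_caps (s : Bool) (n m : ℕ) :
    IsTangle s (m + 2 * n) (caps 0 n : Diagram P) m := by
  induction n with
  | zero => simp [caps, IsTangle]
  | succ n ih =>
    have : (caps 0 (n + 1) : Diagram P) = [⟨n, Piece.cap⟩] ++ caps 0 n := by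
      simp [caps, List.range_succ]
    rw [this]
    refine isTangle_append.2 ⟨_, ?_, ih⟩
    simp [IsTangle, Piece.bot, Piece.top, Piece.Fits]; omega

theorem cups_succ_last (i n : ℕ) :
    (cups i (n + 1) : Diagram P) = cups i n ++ [⟨i + n, Piece.cup⟩] := by
  simp [cups, List.range_succ]

theorem cups_succ (i n : ℕ) :
    (cups i (n + 1) : Diagram P) = ⟨i, Piece.cup⟩ :: cups (i + 1) n := by
  simp only [cups, List.range_succ_eq_map, List.map_cons, List.map_map]
  simp only [Function.comp_def, Nat.add_zero, Nat.succ_eq_add_one, Nat.add_assoc,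
    Nat.add_comm 1]

theorem shift_zero (D : Diagram P) : shift 0 D = D := by
  simp [shift]

theorem shadeAt_add (s : Bool) (i j : ℕ) : shadeAt (shadeAt s i) j = shadeAt s (i + j) := by
  simp [shadeAt, Nat.bodd_add]

theorem isTangle_shift {s : Bool} {D : Diagram P} {i k l n : ℕ}
    (h : IsTangle (shadeAt s i) k D l) (hn : i + k ≤ n) :
    IsTangle s n (shift i D) (n - k + l) := by
  induction D generalizing k n with
  | nil => obtain rfl : k = l := h; simp [IsTangle, shift]; omega
  | cons a D ih =>
    obtain ⟨h1, h2, h3⟩ := h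
    refine ⟨by dsimp; omega, by rw [shadeAt_add] at h2; exact h2, ?_⟩
    have := ih h3 (n := n - a.piece.bot + a.piece.top) (by omega)
    have hle := le_of_add_le_right h1
    convert this using 1
    · rfl
    · omega

theorem isTangle_closeRight {n : ℕ} {s : Bool} (x : P n s) (m : ℕ) :
    IsTangle s m (closeRight x) m := by
  refine isTangle_append.2 ⟨_, isTangle_append.2 ⟨_, isTangle_cups s n m, ?_⟩, isTangle_caps s n m⟩
  exact isTangle_box x (by omega) (by simp [shadeAt])

/-! ### Local replacement of diagrams, and the circle split off by a turn-back. -/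

namespace CStarPlanarAlgebra

variable [∀ n s, CStarAlgebra (P n s)] (PA : CStarPlanarAlgebra P)

/-- Diagrams with `n` strings at the bottom and `m` strings at the top that can be exchanged for
each other inside every larger diagram. -/
def Interchangeable (s : Bool) (n m : ℕ) (A B : Diagram P) : Prop :=
  ∀ (k : ℕ) (C D : Diagram P), IsTangle s k C n → IsTangle s m D k →
    PA.Z k s (C ++ A ++ D) = PA.Z k s (C ++ B ++ D)

variable {PA}

namespace Interchangeable

variable {s : Bool} {n m l : ℕ} {A B A' B' : Diagram P}

theorem refl (A : Diagram P) : PA.Interchangeable s n m A A := fun _ _ _ _ _ => rfl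

theorem symm (h : PA.Interchangeable s n m A B) : PA.Interchangeable s n m B A :=
  fun k C D hC hD => (h k C D hC hD).symm

theorem trans (h : PA.Interchangeable s n m A B) (h' : PA.Interchangeable s n m B B') :
    PA.Interchangeable s n m A B' :=
  fun k C D hC hD => (h k C D hC hD).trans (h' k C D hC hD)

theorem append_left (hA : IsTangle s n A m) (h : PA.Interchangeable s m l B B') :
    PA.Interchangeable s n l (A ++ B) (A ++ B') := fun k C D hC hD => by
  simpa using h k (C ++ A) D (isTangle_append.2 ⟨_, hC, hA⟩) hD

theorem append_right (hB : IsTangle s m B l) (h : PA.Interchangeable s n m A A') :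
    PA.Interchangeable s n l (A ++ B) (A' ++ B) := fun k C D hC hD => by
  simpa using h k C (B ++ D) hC (isTangle_append.2 ⟨_, hB, hD⟩)

theorem of_move (h : Move A B) (hA : IsTangle s n A m) (hB : IsTangle s n B m) :
    PA.Interchangeable s n m A B := fun k C D hC hD =>
  PA.isotopy k s C A B D h
    (isTangle_append.2 ⟨_, isTangle_append.2 ⟨_, hC, hA⟩, hD⟩)
    (isTangle_append.2 ⟨_, isTangle_append.2 ⟨_, hC, hB⟩, hD⟩)

theorem glue_zero {k : ℕ} {E : Diagram P} (hE : IsTangle s k E k) (hi : k ≤ n) :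
    PA.Interchangeable s n n [⟨0, Piece.box k s (PA.Z k s E)⟩] E :=
  fun j C D hC hD => by
    have := PA.gluing j s C D E 0 k s hE
      (isTangle_append.2 ⟨_, isTangle_append.2 ⟨_, hC, isTangle_box _ (by omega) (by simp [shadeAt])⟩, hD⟩)
    rwa [shift_zero] at this

theorem Z_eq (h : PA.Interchangeable s n n A B) : PA.Z n s A = PA.Z n s B := by
  simpa using h n [] [] rfl rfl

/-- Surroundings of a mirror image are mirror images of surroundings, so `star` transports the
equality. Isotopies near the minima thus also serve near the maxima. -/
theorem reflect (h : PA.Interchangeable s n m A B) (hA : IsTangle s n A m)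
    (hB : IsTangle s n B m) :
    PA.Interchangeable s m n (PlanarAlg.reflect A) (PlanarAlg.reflect B) := fun k C D hC hD => by
  have hC' := isTangle_reflect hC
  have hD' := isTangle_reflect hD
  have := congrArg star (h k _ _ hD' hC')
  rw [PA.Z_star _ _ _ (isTangle_append.2 ⟨_, isTangle_append.2 ⟨_, hD', hA⟩, hC'⟩),
    PA.Z_star _ _ _ (isTangle_append.2 ⟨_, isTangle_append.2 ⟨_, hD', hB⟩, hC'⟩)] at this
  simpa [reflect_append, reflect_reflect] using this

end Interchangeable

variable {s : Bool} {n m : ℕ}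

theorem Z_append {A B : Diagram P} (hA : IsTangle s n A n) (hB : IsTangle s n B n) :
    PA.Z n s (A ++ B) = PA.Z n s A * PA.Z n s B := by
  rw [← PA.Z_mul]
  have h1 := Interchangeable.glue_zero (PA := PA) hA le_rfl
  have h2 := Interchangeable.glue_zero (PA := PA) hB le_rfl
  exact ((h1.append_right hB).symm.trans (h2.append_left
    (isTangle_box _ (by omega) (by simp [shadeAt]))).symm).Z_eq

/-- A `0`-box in the leftmost region can change its height freely. -/
theorem interchangeable_zero_box (g : P 0 s) {A : Diagram P} (hA : IsTangle s n A m) :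
    PA.Interchangeable s n m ([⟨0, Piece.box 0 s g⟩] ++ A) (A ++ [⟨0, Piece.box 0 s g⟩]) := by
  induction A generalizing n with
  | nil => exact .refl _
  | cons a A ih =>
    obtain ⟨h1, h2, h3⟩ := hA
    have ha : IsTangle s n [a] (n - a.piece.bot + a.piece.top) := ⟨h1, h2, rfl⟩
    have hg : ∀ j, IsTangle s j [(⟨0, Piece.box 0 s g⟩ : Slice P)] j := fun j =>
      isTangle_box _ (by omega) (by simp [shadeAt])
    have := Move.exchange 0 a.pos (Piece.box 0 s g) a.piece
    simp only [Piece.top, Piece.bot, Nat.zero_add] at this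
    have e1 := (Interchangeable.of_move (PA := PA) this (isTangle_append.2 ⟨_, hg n, ha⟩)
      (isTangle_append.2 ⟨_, ha, hg _⟩)).append_right h3
    exact e1.trans ((ih h3).append_left ha)

theorem interchangeable_cups_cap (n m : ℕ) :
    PA.Interchangeable s (m + 2) (m + 2 * n) (cups 2 n ++ [⟨0, Piece.cap⟩])
      ([⟨0, Piece.cap⟩] ++ cups 0 n) := by
  induction n with
  | zero => exact .refl _
  | succ n ih =>
    rw [cups_succ_last, cups_succ_last]
    have := Move.exchange (P := P) 0 n Piece.cap Piece.cup
    simp only [Piece.top, Piece.bot, Nat.zero_add] at this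
    have h1 : IsTangle s (m + 2) (cups 2 n : Diagram P) (m + 2 + 2 * n) := by
      have := isTangle_shift (i := 2) (n := m + 2) (isTangle_cups (P := P) (shadeAt s 2) n 0) (by omega)
      simpa [shift, cups, Function.comp_def] using this
    have e1 := (Interchangeable.of_move (PA := PA) (s := s) (n := m + 2 + 2 * n) (m := m + 2 * (n + 1)) this
      (by simp [IsTangle, Piece.bot, Piece.top, Piece.Fits]; omega)
      (by simp [IsTangle, Piece.bot, Piece.top, Piece.Fits]; omega)).append_left h1
    have e2 := ih.append_right (B := [⟨n, Piece.cup⟩]) (l := m + 2 * (n + 1))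
      (by simp [IsTangle, Piece.bot, Piece.top, Piece.Fits]; omega)
    simp only [List.append_assoc, List.cons_append, List.nil_append, Nat.zero_add] at e1 e2 ⊢
    exact e1.symm.trans e2

/-- The cap forms a zigzag with the two outermost minima, which leaves one minimum; the inner minima
merely slide past the cap. -/
theorem interchangeable_cups_add_two_cap (n m : ℕ) :
    PA.Interchangeable s m (m + 2 + 2 * n) (cups 0 (n + 2) ++ [⟨0, Piece.cap⟩])
      ([⟨0, Piece.cup⟩] ++ cups 0 n) := by
  rw [cups_succ, cups_succ]
  have e1 := (interchangeable_cups_cap (PA := PA) (s := s) n (m + 2)).append_left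
    (A := [⟨0, Piece.cup⟩, ⟨1, Piece.cup⟩]) (n := m)
    (by simp [IsTangle, Piece.bot, Piece.top, Piece.Fits])
  have e2 := ((Interchangeable.of_move (PA := PA) (s := s) (n := m + 2) (m := m + 2) (Move.zigzag_right 0)
      (by simp [IsTangle, Piece.bot, Piece.top, Piece.Fits])
      (by simp [IsTangle])).append_left (A := [⟨0, Piece.cup⟩]) (n := m)
      (by simp [IsTangle, Piece.bot, Piece.top, Piece.Fits])).append_right
      (isTangle_cups s n (m + 2))
  exact e1.trans e2

/-- The circle in a region of sign `s`. -/
def circle (PA : CStarPlanarAlgebra P) (s : Bool) : P 0 s :=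
  PA.Z 0 s [⟨0, Piece.cup⟩, ⟨0, Piece.cap⟩]

/-- The closure of all strings on the right. -/
def closure (PA : CStarPlanarAlgebra P) {n : ℕ} {s : Bool} (x : P n s) : P 0 s :=
  PA.Z 0 s (closeRight x)

/-- Below and above `D`, the turn-back straightens against the two outermost closing strings. What
remains is one loop to the right of the closure of `D`, and that closure is a `0`-box in the
leftmost region, which slides below the loop. -/
theorem closure_turnback {D : Diagram P} (hD : IsTangle s n D n) :
    PA.closure (PA.Z (n + 2) s ([⟨0, Piece.cap⟩] ++ D ++ [⟨0, Piece.cup⟩])) =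
      PA.closure (PA.Z n s D) * PA.circle s := by
  have hcup : ∀ m, IsTangle s m [(⟨0, Piece.cup⟩ : Slice P)] (m + 2) := fun m => by
    simp [IsTangle, Piece.bot, Piece.top, Piece.Fits]
  have hcap : ∀ m, IsTangle s (m + 2) [(⟨0, Piece.cap⟩ : Slice P)] m := fun m => by
    simp [IsTangle, Piece.bot, Piece.top, Piece.Fits]
  have hD' : ∀ k, IsTangle s (k + n) D (k + n) := fun k => by
    have := isTangle_shift (i := 0) (n := k + n) (s := s) (by simpa [shadeAt] using hD) (by omega)
    simpa [shift_zero] using this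
  have hE : IsTangle s (n + 2) ([⟨0, Piece.cap⟩] ++ D ++ [⟨0, Piece.cup⟩]) (n + 2) :=
    isTangle_append.2 ⟨_, isTangle_append.2 ⟨_, hcap n, hD⟩, hcup n⟩
  have e0 := ((Interchangeable.glue_zero (PA := PA) (n := 0 + 2 * (n + 2)) hE (by omega)).append_left
    (isTangle_cups s (n + 2) 0)).append_right (isTangle_caps s (n + 2) 0)
  have f1 := interchangeable_cups_add_two_cap (PA := PA) (s := s) n 0
  have f2 := f1.reflect (isTangle_append.2 ⟨_, isTangle_cups s (n + 2) 0, by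
      simp [IsTangle, Piece.bot, Piece.top, Piece.Fits]; omega⟩)
    (isTangle_append.2 ⟨_, hcup 0, isTangle_cups s n _⟩)
  rw [reflect_append, reflect_append, reflect_cups, reflect_cups] at f2
  change PA.Interchangeable s _ _ ([⟨0, Piece.cup⟩] ++ caps 0 (n + 2))
    (caps 0 n ++ [⟨0, Piece.cap⟩]) at f2
  have hD2 : IsTangle s (0 + 2 + 2 * n) D (0 + 2 + 2 * n) := by
    have := hD' (n + 2); convert this using 1 <;> omega
  have e1 := f1.append_right (isTangle_append.2 ⟨_, hD2, isTangle_append.2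
    ⟨_, hcup _, (by convert isTangle_caps s (n + 2) 0 using 1; omega : IsTangle s _ (caps 0 (n + 2)) 0)⟩⟩)
  have e2 := f2.append_left (isTangle_append.2 ⟨_, isTangle_append.2 ⟨_, hcup 0, isTangle_cups s n _⟩, hD2⟩)
  have hcl := (Interchangeable.glue_zero (PA := PA) (n := 2 * n + 2) hD (by omega))
  have e3 := (hcl.append_left (A := [⟨0, Piece.cup⟩] ++ cups 0 n) (n := 0)
    (isTangle_append.2 ⟨_, hcup 0, by convert isTangle_cups s n 2 using 1; omega⟩)).append_right
    (B := caps 0 n ++ [⟨0, Piece.cap⟩]) (l := 0)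
    (isTangle_append.2 ⟨_, by convert isTangle_caps s n 2 using 1; omega, hcap 0⟩)
  have e4 := (Interchangeable.glue_zero (PA := PA) (n := 2) (isTangle_closeRight (PA.Z n s D) 0)
    (by omega)).append_left (hcup 0) |>.append_right (hcap 0)
  have e5 := (interchangeable_zero_box (PA := PA) (PA.closure (PA.Z n s D)) (hcup 0)).append_right (hcap 0)
  have hcirc : IsTangle s 0 [⟨0, Piece.cup⟩, (⟨0, Piece.cap⟩ : Slice P)] 0 :=
    isTangle_append.2 ⟨_, hcup 0, hcap 0⟩
  have r0 := e0.Z_eq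
  have r1 := e1.Z_eq
  have r2 := e2.Z_eq
  have r3 := e3.Z_eq
  have r4 := e4.Z_eq
  have r5 := e5.Z_eq
  have r6 := Z_append (PA := PA) (isTangle_box (s := s) (n := 0) (i := 0) (PA.closure (PA.Z n s D)) (by omega) (by simp [shadeAt])) hcirc
  rw [PA.identity] at r6
  simp only [List.append_assoc, List.cons_append, List.nil_append] at r0 r1 r2 r3 r4 r5 r6
  simp only [closure, closeRight, List.append_assoc, List.cons_append, List.nil_append] at *
  rw [r0, r1, r2, ← r3, ← r4, ← r5]
  exact r6

end CStarPlanarAlgebra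

end PlanarAlg

/-! ### Functional calculus in finite dimension, and positivity tested by a faithful functional. -/

section FaithfulFunctional

open scoped ComplexOrder

theorem spectrum_finite_of_finiteDimensional {K A : Type*} [Field K] [Ring A] [Algebra K A]
    [FiniteDimensional K A] (a : A) : (spectrum K a).Finite := by
  have hint := Algebra.IsIntegral.isIntegral (R := K) a
  refine ((minpoly K a).rootSet_finite K).subset fun t ht => ?_
  have h := spectrum.subset_polynomial_aeval a (minpoly K a) ⟨t, ht, rfl⟩
  rw [minpoly.aeval] at h
  rw [Polynomial.mem_rootSet]
  refine ⟨minpoly.ne_zero hint, ?_⟩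
  rw [Polynomial.coe_aeval_eq_eval]
  by_contra h0
  rw [spectrum.mem_iff, sub_zero] at h
  exact h ((IsUnit.mk0 _ h0).map (algebraMap K A))

/-- The spectrum is finite, so the functional calculus also accepts discontinuous functions, such as
indicators and inverses with `0⁻¹ = 0`. -/
theorem continuousOn_spectrum_of_finiteDimensional {A : Type*} [Ring A] [Algebra ℝ A]
    [FiniteDimensional ℝ A] (a : A) (f : ℝ → ℝ) : ContinuousOn f (spectrum ℝ a) := by
  have := (spectrum_finite_of_finiteDimensional (K := ℝ) a)
  exact this.continuousOn f

variable {A : Type*} [CStarAlgebra A]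

/-- An element is positive if all its conjugates take nonnegative values under a faithful
functional. -/
theorem nonneg_of_faithful_functional [PartialOrder A] [StarOrderedRing A] (φ : A →ₗ[ℂ] ℂ)
    (hφ : ∀ k : A, k ≠ 0 → 0 < φ (star k * k)) {z : A} (hz : IsSelfAdjoint z)
    (h : ∀ a : A, 0 ≤ φ (star a * z * a)) : 0 ≤ z := by
  -- `k` is the negative part of `z` and `a` is its square root, so conjugating `z` by `a` gives
  -- `-k²`; faithfulness then forces `k = 0`.
  set a := cfc (fun t : ℝ => √(-t)) z with ha
  set k := cfc (fun t : ℝ => max (-t) 0) z with hk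
  have hsa : star a = a := IsSelfAdjoint.star_eq (cfc_predicate _ _)
  have hsk : star k = k := IsSelfAdjoint.star_eq (cfc_predicate _ _)
  have key : star a * z * a = -(star k * k) := by
    rw [hsa, hsk]
    conv_lhs => rw [← cfc_id' ℝ z]
    rw [ha, cfc_id' ℝ z]
    nth_rw 2 [← cfc_id' ℝ z]
    rw [hk, ← cfc_mul _ _ z, ← cfc_mul _ _ z, ← cfc_mul _ _ z, ← cfc_neg _ z]
    refine cfc_congr fun t _ => ?_
    rcases le_total 0 t with ht | ht
    · simp [Real.sqrt_eq_zero_of_nonpos (neg_nonpos.2 ht), ht]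
    · have := Real.mul_self_sqrt (neg_nonneg.2 ht)
      simp only [max_eq_left (neg_nonneg.2 ht)]
      linear_combination t * this
  have hk0 : k = 0 := by
    by_contra hne
    have h1 := h a
    rw [key, map_neg] at h1
    exact absurd (hφ k hne) (by simpa using not_lt_of_ge (neg_nonneg.1 h1))
  rw [← cfc_id' ℝ z]
  refine cfc_nonneg fun t ht => ?_
  rw [hk, ← cfc_zero (R := ℝ) z, cfc_eq_cfc_iff_eqOn] at hk0
  simpa using hk0 ht

end FaithfulFunctional

/-! ### Traces, the circle, and reflection positivity. -/

namespace PlanarAlg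
variable {P : ℕ → Bool → Type u}

theorem isTangle_zero_box {s : Bool} (g : P 0 s) (n : ℕ) : IsTangle s n [⟨0, Piece.box 0 s g⟩] n :=
  isTangle_box g (by omega) (by simp [shadeAt])

theorem isTangle_full_box {n : ℕ} {s : Bool} (g : P n s) : IsTangle s n [⟨0, Piece.box n s g⟩] n :=
  isTangle_box g (by omega) (by simp [shadeAt])

variable [∀ n s, CStarAlgebra (P n s)]

/-- The action of a diagram as a linear function of the contents of one of its boxes. -/
noncomputable def PlanarAlgebra.boxMap (PA : PlanarAlgebra P) (n : ℕ) (s : Bool) (C D : Diagram P) (i k : ℕ)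
    (ε : Bool) (h : ∀ x : P k ε, IsTangle s n (C ++ [⟨i, Piece.box k ε x⟩] ++ D) n) :
    P k ε →ₗ[ℂ] P n s :=
  have hz : PA.Z n s (C ++ [⟨i, Piece.box k ε 0⟩] ++ D) = 0 := by
    have := PA.multilinear n s C D i k ε 1 0 0 (h 0)
    simpa using this
  { toFun := fun x => PA.Z n s (C ++ [⟨i, Piece.box k ε x⟩] ++ D)
    map_add' := fun x y => by simpa using PA.multilinear n s C D i k ε 1 x y (h x)
    map_smul' := fun c x => by
      have := PA.multilinear n s C D i k ε c x 0 (h x)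
      rw [hz] at this
      simpa using this }

namespace CStarPlanarAlgebra

open scoped ComplexOrder

variable (PA : CStarPlanarAlgebra P)

/-- The trace that closes all strings on the right. -/
noncomputable def trace (n : ℕ) (s : Bool) : P n s →ₗ[ℂ] ℂ :=
  PA.tr₀ s ∘ₗ PA.boxMap 0 s (cups 0 n) (caps 0 n) 0 n s fun x => isTangle_closeRight x 0

variable {PA} {n : ℕ} {s : Bool}

theorem trace_apply (x : P n s) : PA.trace n s x = PA.tr₀ s (PA.closure x) := rfl

theorem trace_star_mul_self_pos (x : P n s) (hx : x ≠ 0) : 0 < PA.trace n s (star x * x) := by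
  obtain ⟨t, ht, h⟩ := PA.trace_pos n s x hx
  rw [trace_apply]
  change 0 < PA.tr₀ s (PA.Z 0 s _)
  rw [h]
  exact_mod_cast ht

theorem trace_star_mul_self_nonneg (x : P n s) : 0 ≤ PA.trace n s (star x * x) := by
  by_cases hx : x = 0
  · simp [hx]
  · exact (trace_star_mul_self_pos x hx).le

theorem closure_of_zero (x : P 0 s) : PA.closure x = x := PA.identity 0 s x

theorem zero_box_mul_comm (PA : CStarPlanarAlgebra P) (a b : P 0 s) : a * b = b * a := by
  rw [← PA.Z_mul, ← PA.Z_mul]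
  exact (interchangeable_zero_box a (isTangle_zero_box b 0)).Z_eq

theorem closure_Z {E : Diagram P} (hE : IsTangle s n E n) :
    PA.closure (PA.Z n s E) = PA.Z 0 s (cups 0 n ++ E ++ caps 0 n) :=
  (((Interchangeable.glue_zero (PA := PA) (n := 0 + 2 * n) hE (by omega)).append_left
    (isTangle_cups s n 0)).append_right (isTangle_caps s n 0)).Z_eq

/-- The `0`-box lies in the leftmost region, outside the closing strings, so it can slide below
them. -/
theorem closure_zero_box_mul (g : P 0 s) (x : P n s) :
    PA.closure (PA.Z n s [⟨0, Piece.box 0 s g⟩] * x) = g * PA.closure x := by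
  have hx := PA.identity n s x
  conv_lhs => rw [← hx]
  rw [← Z_append (isTangle_zero_box g n) (isTangle_full_box x),
    closure_Z (isTangle_append.2 ⟨_, isTangle_zero_box g n, isTangle_full_box x⟩)]
  conv_rhs => rw [← PA.identity 0 s g]
  rw [closure, ← Z_append (isTangle_zero_box g 0) (isTangle_closeRight x 0)]
  have e := ((interchangeable_zero_box (PA := PA) g (isTangle_cups s n 0)).append_right
    (isTangle_append.2 ⟨_, isTangle_box x (n := 0 + 2 * n) (i := 0) (s := s) (by omega) (by simp [shadeAt]),
      isTangle_caps s n 0⟩)).Z_eq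
  simp only [closeRight, List.append_assoc] at e ⊢
  exact e.symm

theorem closure_one_string : PA.closure (1 : P 1 s) = PA.circle s := by
  rw [← PA.Z_one, closure_Z (show IsTangle s 1 [] 1 from rfl)]
  rfl

theorem zero_box_commute (g : P 0 s) (x : P n s) :
    PA.Z n s [⟨0, Piece.box 0 s g⟩] * x = x * PA.Z n s [⟨0, Piece.box 0 s g⟩] := by
  conv_lhs => rw [← PA.identity n s x]
  conv_rhs => rw [← PA.identity n s x]
  rw [← Z_append (isTangle_zero_box g n) (isTangle_full_box x),
    ← Z_append (isTangle_full_box x) (isTangle_zero_box g n)]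
  exact (interchangeable_zero_box g (isTangle_full_box x)).Z_eq

theorem zero_box_mul (a b : P 0 s) (n : ℕ) :
    PA.Z n s [⟨0, Piece.box 0 s (a * b)⟩] =
      PA.Z n s [⟨0, Piece.box 0 s a⟩] * PA.Z n s [⟨0, Piece.box 0 s b⟩] := by
  rw [← Z_append (isTangle_zero_box a n) (isTangle_zero_box b n)]
  conv_lhs => rw [← PA.Z_mul]
  exact (Interchangeable.glue_zero (PA := PA) (isTangle_append.2
    ⟨_, isTangle_zero_box a 0, isTangle_zero_box b 0⟩) (Nat.zero_le n)).Z_eq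

theorem star_zero_box (g : P 0 s) (n : ℕ) :
    star (PA.Z n s [⟨0, Piece.box 0 s g⟩]) = PA.Z n s [⟨0, Piece.box 0 s (star g)⟩] :=
  PA.Z_star n s _ (isTangle_zero_box g n)

theorem star_circle : star (PA.circle s) = PA.circle s :=
  PA.Z_star 0 s _ (by simp [IsTangle, Piece.bot, Piece.top, Piece.Fits])

theorem trace_zero_box (g : P 0 s) :
    PA.trace 1 s (star (PA.Z 1 s [⟨0, Piece.box 0 s g⟩]) * PA.Z 1 s [⟨0, Piece.box 0 s g⟩]) =
      PA.tr₀ s (star g * PA.circle s * g) := by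
  rw [star_zero_box, ← zero_box_mul, trace_apply, ← mul_one (PA.Z 1 s _), closure_zero_box_mul,
    closure_one_string, mul_assoc, mul_assoc, zero_box_mul_comm PA g]

/-- Under `tr₀`, the conjugate of the circle by `a` becomes the trace of a square in the `1`-boxes,
namely of `a` beside a string. -/
theorem circle_nonneg [∀ n s, PartialOrder (P n s)] [∀ n s, StarOrderedRing (P n s)] :
    0 ≤ PA.circle s := by
  refine nonneg_of_faithful_functional (PA.tr₀ s) (fun k hk => ?_) star_circle fun a => ?_
  · have := trace_star_mul_self_pos (PA := PA) k hk
    rwa [trace_apply, closure_of_zero] at this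
  · rw [← trace_zero_box]
    exact trace_star_mul_self_nonneg _

/-- A `0`-box that annihilates the circle vanishes next to a string. -/
theorem zero_box_eq_zero (hn : 1 ≤ n) {g : P 0 s} (hg : g * PA.circle s = 0) :
    PA.Z n s [⟨0, Piece.box 0 s g⟩] = 0 := by
  -- Closing the string beside `g` produces the circle, so the faithful trace of the corresponding
  -- square is zero.
  have h1 : PA.Z 1 s [⟨0, Piece.box 0 s g⟩] = 0 := by
    by_contra hne
    have := trace_star_mul_self_pos (PA := PA) _ hne
    rw [trace_zero_box, mul_assoc, zero_box_mul_comm PA _ g, hg] at this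
    simp at this
  have h2 := (Interchangeable.glue_zero (PA := PA) (isTangle_zero_box g 1) hn).Z_eq
  rw [← h2, h1]
  exact (PA.boxMap n s [] [] 0 1 s fun x => isTangle_box x (by omega) (by simp [shadeAt])).map_zero

/-- `D` is not square and has no trace of its own; with a cup on top it lies in the algebra of `(n +
2)`-boxes, and the turn-back costs one circle. -/
theorem trace_turnback_nonneg {D : Diagram P} (hD : IsTangle s (n + 2) D n) :
    0 ≤ PA.tr₀ s (PA.closure (PA.Z n s (reflect D ++ D)) * PA.circle s) := by
  have hD' := isTangle_reflect hD
  have hcup : IsTangle s n [(⟨0, Piece.cup⟩ : Slice P)] (n + 2) := by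
    simp [IsTangle, Piece.bot, Piece.top, Piece.Fits]
  have hcap : IsTangle s (n + 2) [(⟨0, Piece.cap⟩ : Slice P)] n := by
    simp [IsTangle, Piece.bot, Piece.top, Piece.Fits]
  have hW : IsTangle s (n + 2) (D ++ [⟨0, Piece.cup⟩]) (n + 2) := isTangle_append.2 ⟨_, hD, hcup⟩
  have := trace_star_mul_self_nonneg (PA := PA) (PA.Z (n + 2) s (D ++ [⟨0, Piece.cup⟩]))
  rw [PA.Z_star _ _ _ hW, ← Z_append (isTangle_reflect hW) hW, trace_apply] at this
  rw [← closure_turnback (isTangle_append.2 ⟨_, hD', hD⟩)]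
  simpa [reflect_append, reflect, Piece.reflect] using this

theorem reflect_append_box {D : Diagram P} (hD : IsTangle s m D n) (k : ℕ) (hk : k ≤ n) (a : P k s) :
    PA.Z n s (reflect (D ++ [⟨0, Piece.box k s a⟩]) ++ (D ++ [⟨0, Piece.box k s a⟩])) =
      star (PA.Z n s [⟨0, Piece.box k s a⟩]) * PA.Z n s (reflect D ++ D) *
        PA.Z n s [⟨0, Piece.box k s a⟩] := by
  have ha : ∀ a : P k s, IsTangle s n [⟨0, Piece.box k s a⟩] n := fun a =>
    isTangle_box a (by omega) (by simp [shadeAt])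
  have hDD : IsTangle s n (reflect D ++ D) n := isTangle_append.2 ⟨_, isTangle_reflect hD, hD⟩
  have hs : star (PA.Z n s [⟨0, Piece.box k s a⟩]) = PA.Z n s [⟨0, Piece.box k s (star a)⟩] :=
    PA.Z_star n s _ (ha a)
  rw [hs, ← Z_append (ha (star a)) hDD,
    ← Z_append (isTangle_append.2 ⟨_, ha (star a), hDD⟩) (ha a), reflect_append]
  simp [reflect, Piece.reflect]

/-- The circle in `trace_turnback_nonneg` is cancelled by placing an inverse square root of it in
the leftmost region of `D`. -/
theorem trace_reflect_append_nonneg (hn : 1 ≤ n) {D : Diagram P} (hD : IsTangle s (n + 2) D n) :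
    0 ≤ PA.trace n s (PA.Z n s (reflect D ++ D)) := by
  let _ := fun n s => CStarAlgebra.spectralOrder (P n s)
  have _ := fun n s => CStarAlgebra.spectralOrderedRing (P n s)
  have : FiniteDimensional ℂ (P 0 s) := PA.finiteDimensional 0 s
  have : FiniteDimensional ℝ (P 0 s) := FiniteDimensional.complexToReal _
  have hpos := circle_nonneg (PA := PA) (s := s)
  have hcont := continuousOn_spectrum_of_finiteDimensional (PA.circle s)
  have hsa : IsSelfAdjoint (PA.circle s) := star_circle
  -- As `0⁻¹ = 0`, this is a generalized inverse root: `h * circle * h` is the support projection of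
  -- the circle.
  set h := cfc (fun t : ℝ => (√t)⁻¹) (PA.circle s) with hh
  have hsh : star h = h := IsSelfAdjoint.star_eq (cfc_predicate _ _)
  have hker : (1 - h * PA.circle s * h) * PA.circle s = 0 := by
    rw [sub_mul, one_mul, sub_eq_zero]
    have : h * PA.circle s * h * PA.circle s =
        cfc (fun t : ℝ => (√t)⁻¹ * t * (√t)⁻¹ * t) (PA.circle s) := by
      rw [cfc_mul _ _ _ (hcont _) (hcont _), cfc_mul _ _ _ (hcont _) (hcont _),
        cfc_mul _ _ _ (hcont _) (hcont _), cfc_id' ℝ (PA.circle s)]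
    rw [this]
    conv_lhs => rw [← cfc_id' ℝ (PA.circle s)]
    refine cfc_congr fun t ht => ?_
    have ht0 : 0 ≤ t := spectrum_nonneg_of_nonneg hpos ht
    rcases eq_or_lt_of_le ht0 with rfl | h0
    · simp
    · have := Real.sqrt_pos.2 h0
      have h2 := Real.mul_self_sqrt ht0
      field_simp
      nlinarith
  -- The defect `1 - h * circle * h` is killed by the circle, hence invisible beside a string; this
  -- needs `1 ≤ n`.
  have hz := zero_box_eq_zero (PA := PA) hn hker
  set q := PA.closure (PA.Z n s (reflect D ++ D)) with hq
  have hzq : (1 - h * PA.circle s * h) * q = 0 := by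
    rw [hq, ← closure_zero_box_mul, hz, zero_mul]
    exact (PA.boxMap 0 s (cups 0 n) (caps 0 n) 0 n s fun x => isTangle_closeRight x 0).map_zero
  -- `h` and its mirror image contribute `h * h`, which cancels the circle on `q`.
  have hmain := trace_turnback_nonneg (PA := PA) (D := D ++ [⟨0, Piece.box 0 s h⟩])
    (isTangle_append.2 ⟨_, hD, isTangle_zero_box h n⟩)
  rw [reflect_append_box hD 0 (Nat.zero_le n), ← zero_box_commute, star_zero_box, hsh, ← mul_assoc,
    mul_assoc, closure_zero_box_mul, closure_zero_box_mul, ← hq] at hmain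
  rw [trace_apply, ← hq]
  rw [sub_mul, one_mul, sub_eq_zero] at hzq
  rwa [mul_assoc, zero_box_mul_comm PA _ (PA.circle s), ← mul_assoc, ← mul_assoc, ← hzq] at hmain

/-- Reflection positivity for diagrams that lower the number of strings by two. -/
theorem reflect_append_nonneg [PartialOrder (P n s)] [StarOrderedRing (P n s)] (hn : 1 ≤ n)
    {D : Diagram P} (hD : IsTangle s (n + 2) D n) : 0 ≤ PA.Z n s (reflect D ++ D) := by
  have hDD : IsTangle s n (reflect D ++ D) n := isTangle_append.2 ⟨_, isTangle_reflect hD, hD⟩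
  refine nonneg_of_faithful_functional (PA.trace n s) trace_star_mul_self_pos ?_ fun a => ?_
  · rw [IsSelfAdjoint, PA.Z_star n s _ hDD, reflect_append, reflect_reflect]
  -- Placing `a` on top of `D` conjugates the element by `a`, so the trace inequality holds for
  -- every conjugate.
  · have h1 := trace_reflect_append_nonneg (PA := PA) hn (D := D ++ [⟨0, Piece.box n s a⟩])
      (isTangle_append.2 ⟨_, hD, isTangle_full_box a⟩)
    rwa [reflect_append_box hD n le_rfl, PA.identity] at h1

/-! ### Positivity of convolutions. -/

variable {PA : CStarPlanarAlgebra P} {s : Bool}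

/-- Write `y` and `w` as squares of `b` and `c` and slide the factors past each other: the diagram
is then symmetric about a horizontal line, with upper half `b`, `c` and a cap. -/
theorem conv_nonneg [PartialOrder (P 1 s)] [StarOrderedRing (P 1 s)] [PartialOrder (P 2 !s)]
    [StarOrderedRing (P 2 !s)] {y : P 1 s} {w : P 2 (!s)} (hy : 0 ≤ y) (hw : 0 ≤ w) :
    0 ≤ PA.conv y w := by
  obtain ⟨b, rfl⟩ := CStarAlgebra.nonneg_iff_eq_star_mul_self.1 hy
  obtain ⟨c, rfl⟩ := CStarAlgebra.nonneg_iff_eq_star_mul_self.1 hw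
  have h := reflect_append_nonneg (PA := PA) (n := 1) (s := s) le_rfl
    (D := [⟨0, Piece.box 1 s b⟩, ⟨1, Piece.box 2 (!s) c⟩, ⟨0, Piece.cap⟩])
    (by simp [IsTangle, Piece.bot, Piece.top, Piece.Fits, shadeAt])
  have e0 := PA.gluing 1 s [⟨0, Piece.cup⟩] [⟨1, Piece.box 2 (!s) (star c * c)⟩, ⟨0, Piece.cap⟩]
    [⟨0, Piece.box 1 s (star b)⟩, ⟨0, Piece.box 1 s b⟩] 0 1 s
    (by simp [IsTangle, Piece.bot, Piece.top, Piece.Fits, shadeAt])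
    (by simp [IsTangle, Piece.bot, Piece.top, Piece.Fits, shadeAt])
  rw [PA.Z_mul] at e0
  have e1 := PA.gluing 1 s [⟨0, Piece.cup⟩, ⟨0, Piece.box 1 s (star b)⟩, ⟨0, Piece.box 1 s b⟩]
    [⟨0, Piece.cap⟩]
    [⟨0, Piece.box 2 (!s) (star c)⟩, ⟨0, Piece.box 2 (!s) c⟩] 1 2 (!s)
    (by simp [IsTangle, Piece.bot, Piece.top, Piece.Fits, shadeAt])
    (by simp [IsTangle, Piece.bot, Piece.top, Piece.Fits, shadeAt])
  rw [PA.Z_mul] at e1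
  have e2 := PA.isotopy 1 s [⟨0, Piece.cup⟩, ⟨0, Piece.box 1 s (star b)⟩] _ _
    [⟨1, Piece.box 2 (!s) c⟩, ⟨0, Piece.cap⟩]
    (Move.exchange 0 0 (Piece.box 1 s b) (Piece.box 2 (!s) (star c)))
    (by simp [IsTangle, Piece.bot, Piece.top, Piece.Fits, shadeAt])
    (by simp [IsTangle, Piece.bot, Piece.top, Piece.Fits, shadeAt])
  have e3 := PA.isotopy 1 s [⟨0, Piece.cup⟩] _ _
    [⟨0, Piece.box 1 s b⟩, ⟨1, Piece.box 2 (!s) c⟩, ⟨0, Piece.cap⟩]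
    (Move.exchange 0 0 (Piece.box 1 s (star b)) (Piece.box 2 (!s) (star c)))
    (by simp [IsTangle, Piece.bot, Piece.top, Piece.Fits, shadeAt])
    (by simp [IsTangle, Piece.bot, Piece.top, Piece.Fits, shadeAt])
  exact h.trans_eq ((e0.trans (e1.trans (e2.trans e3))).symm)

/-- The convolution of two `2`-boxes: the right string of `u` is joined, at both ends, with the
left string of `w`. -/
def convTwo (PA : CStarPlanarAlgebra P) {s : Bool} (u w : P 2 s) : P 2 s :=
  PA.Z 2 s [⟨1, Piece.cup⟩, ⟨0, Piece.box 2 s u⟩, ⟨2, Piece.box 2 s w⟩, ⟨1, Piece.cap⟩]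

theorem convTwo_nonneg [PartialOrder (P 2 s)] [StarOrderedRing (P 2 s)] {u w : P 2 s}
    (hu : 0 ≤ u) (hw : 0 ≤ w) : 0 ≤ PA.convTwo u w := by
  obtain ⟨b, rfl⟩ := CStarAlgebra.nonneg_iff_eq_star_mul_self.1 hu
  obtain ⟨c, rfl⟩ := CStarAlgebra.nonneg_iff_eq_star_mul_self.1 hw
  have h := reflect_append_nonneg (PA := PA) (n := 2) (s := s) one_le_two
    (D := [⟨0, Piece.box 2 s b⟩, ⟨2, Piece.box 2 s c⟩, ⟨1, Piece.cap⟩])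
    (by simp [IsTangle, Piece.bot, Piece.top, Piece.Fits, shadeAt])
  have e0 := PA.gluing 2 s [⟨1, Piece.cup⟩] [⟨2, Piece.box 2 s (star c * c)⟩, ⟨1, Piece.cap⟩]
    [⟨0, Piece.box 2 s (star b)⟩, ⟨0, Piece.box 2 s b⟩] 0 2 s
    (by simp [IsTangle, Piece.bot, Piece.top, Piece.Fits, shadeAt])
    (by simp [IsTangle, Piece.bot, Piece.top, Piece.Fits, shadeAt])
  rw [PA.Z_mul] at e0
  have e1 := PA.gluing 2 s [⟨1, Piece.cup⟩, ⟨0, Piece.box 2 s (star b)⟩, ⟨0, Piece.box 2 s b⟩]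
    [⟨1, Piece.cap⟩]
    [⟨0, Piece.box 2 s (star c)⟩, ⟨0, Piece.box 2 s c⟩] 2 2 s
    (by simp [IsTangle, Piece.bot, Piece.top, Piece.Fits, shadeAt])
    (by simp [IsTangle, Piece.bot, Piece.top, Piece.Fits, shadeAt])
  rw [PA.Z_mul] at e1
  have e2 := PA.isotopy 2 s [⟨1, Piece.cup⟩, ⟨0, Piece.box 2 s (star b)⟩] _ _
    [⟨2, Piece.box 2 s c⟩, ⟨1, Piece.cap⟩]
    (Move.exchange 0 0 (Piece.box 2 s b) (Piece.box 2 s (star c)))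
    (by simp [IsTangle, Piece.bot, Piece.top, Piece.Fits, shadeAt])
    (by simp [IsTangle, Piece.bot, Piece.top, Piece.Fits, shadeAt])
  have e3 := PA.isotopy 2 s [⟨1, Piece.cup⟩] _ _
    [⟨0, Piece.box 2 s b⟩, ⟨2, Piece.box 2 s c⟩, ⟨1, Piece.cap⟩]
    (Move.exchange 0 0 (Piece.box 2 s (star b)) (Piece.box 2 s (star c)))
    (by simp [IsTangle, Piece.bot, Piece.top, Piece.Fits, shadeAt])
    (by simp [IsTangle, Piece.bot, Piece.top, Piece.Fits, shadeAt])
  exact h.trans_eq ((e0.trans (e1.trans (e2.trans e3))).symm)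

/-! ### Adding a string, and the Fourier transform. -/

/-- Convolution by a fixed `2`-box, as a linear map on `1`-boxes. -/
noncomputable def convMap (PA : CStarPlanarAlgebra P) {s : Bool} (w : P 2 (!s)) :
    P 1 s →ₗ[ℂ] P 1 s :=
  PA.boxMap 1 s [⟨0, Piece.cup⟩] [⟨1, Piece.box 2 (!s) w⟩, ⟨0, Piece.cap⟩] 0 1 s
    fun _ => by simp [IsTangle, Piece.bot, Piece.top, Piece.Fits, shadeAt]

/-- Convolution by a fixed `2`-box, as a linear map on `2`-boxes. -/
noncomputable def convTwoMap (PA : CStarPlanarAlgebra P) {s : Bool} (w : P 2 s) :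
    P 2 s →ₗ[ℂ] P 2 s :=
  PA.boxMap 2 s [⟨1, Piece.cup⟩] [⟨2, Piece.box 2 s w⟩, ⟨1, Piece.cap⟩] 0 2 s
    fun _ => by simp [IsTangle, Piece.bot, Piece.top, Piece.Fits, shadeAt]

theorem convTwoMap_apply (w u : P 2 s) : PA.convTwoMap w u = PA.convTwo u w := rfl

/-- The `1`-box `y` to the right of a vertical string. -/
noncomputable def addString (PA : CStarPlanarAlgebra P) (s : Bool) : P 1 s →ₗ[ℂ] P 2 (!s) :=
  PA.boxMap 2 (!s) [] [] 1 1 s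
    fun _ => by simp [IsTangle, Piece.bot, Piece.top, Piece.Fits, shadeAt]

theorem addString_apply (y : P 1 s) :
    PA.addString s y = PA.Z 2 (!s) [⟨1, Piece.box 1 s y⟩] := rfl

theorem addString_one : PA.addString s 1 = 1 := by
  rw [addString_apply, ← PA.Z_one, ← PA.Z_one]
  exact PA.gluing 2 (!s) [] [] [] 1 1 s rfl
    (by simp [IsTangle, Piece.bot, Piece.top, Piece.Fits, shadeAt])

theorem addString_mul (a b : P 1 s) :
    PA.addString s (a * b) = PA.addString s a * PA.addString s b := by
  rw [addString_apply, addString_apply, addString_apply, ← Z_append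
    (by simp [IsTangle, Piece.bot, Piece.top, Piece.Fits, shadeAt])
    (by simp [IsTangle, Piece.bot, Piece.top, Piece.Fits, shadeAt]), ← PA.Z_mul]
  exact PA.gluing 2 (!s) [] [] [⟨0, Piece.box 1 s a⟩, ⟨0, Piece.box 1 s b⟩] 1 1 s
    (by simp [IsTangle, Piece.bot, Piece.top, Piece.Fits, shadeAt])
    (by simp [IsTangle, Piece.bot, Piece.top, Piece.Fits, shadeAt])

theorem addString_star (a : P 1 s) : PA.addString s (star a) = star (PA.addString s a) :=
  (PA.Z_star 2 (!s) [⟨1, Piece.box 1 s a⟩]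
    (by simp [IsTangle, Piece.bot, Piece.top, Piece.Fits, shadeAt])).symm

theorem addString_nonneg [PartialOrder (P 1 s)] [StarOrderedRing (P 1 s)] [PartialOrder (P 2 !s)]
    [StarOrderedRing (P 2 !s)] {y : P 1 s} (hy : 0 ≤ y) : 0 ≤ PA.addString s y := by
  obtain ⟨b, rfl⟩ := CStarAlgebra.nonneg_iff_eq_star_mul_self.1 hy
  rw [addString_mul, addString_star]
  exact star_mul_self_nonneg _

/-- This intertwines the two convolutions. After gluing, both sides are literally the same diagram.
-/
theorem convTwo_addString (y : P 1 s) (w : P 2 (!s)) :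
    PA.convTwo (PA.addString s y) w = PA.addString s (PA.conv y w) := by
  have e1 := PA.gluing 2 (!s) [⟨1, Piece.cup⟩] [⟨2, Piece.box 2 (!s) w⟩, ⟨1, Piece.cap⟩]
    [⟨1, Piece.box 1 s y⟩] 0 2 (!s)
    (by simp [IsTangle, Piece.bot, Piece.top, Piece.Fits, shadeAt])
    (by simp [IsTangle, Piece.bot, Piece.top, Piece.Fits, shadeAt])
  have e2 := PA.gluing 2 (!s) [] [] [⟨0, Piece.cup⟩, ⟨0, Piece.box 1 s y⟩,
    ⟨1, Piece.box 2 (!s) w⟩, ⟨0, Piece.cap⟩] 1 1 s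
    (by simp [IsTangle, Piece.bot, Piece.top, Piece.Fits, shadeAt])
    (by simp [IsTangle, Piece.bot, Piece.top, Piece.Fits, shadeAt])
  exact e1.trans e2.symm

/-- The Fourier transform as a linear map. -/
noncomputable def fourierMap (PA : CStarPlanarAlgebra P) (s : Bool) : P 2 s →ₗ[ℂ] P 2 (!s) :=
  PA.boxMap 2 (!s) [⟨0, Piece.cup⟩] [⟨2, Piece.cap⟩] 1 2 s
    fun _ => by simp [IsTangle, Piece.bot, Piece.top, Piece.Fits, shadeAt]

theorem fourierMap_apply (x : P 2 s) : PA.fourierMap s x = PA.fourier x := rfl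

/-- The anticlockwise rotation by `90` degrees. -/
def fourierInv (PA : CStarPlanarAlgebra P) {s : Bool} (w : P 2 (!s)) : P 2 s :=
  PA.Z 2 s [⟨2, Piece.cup⟩, ⟨1, Piece.box 2 (!s) w⟩, ⟨0, Piece.cap⟩]

theorem fourierInv_fourier (x : P 2 s) : PA.fourierInv (PA.fourier x) = x := by
  have e0 := PA.gluing 2 s [⟨2, Piece.cup⟩] [⟨0, Piece.cap⟩]
    [⟨0, Piece.cup⟩, ⟨1, Piece.box 2 s x⟩, ⟨2, Piece.cap⟩] 1 2 (!s)
    (by simp [IsTangle, Piece.bot, Piece.top, Piece.Fits, shadeAt])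
    (by simp [IsTangle, Piece.bot, Piece.top, Piece.Fits, shadeAt])
  have e1 := PA.isotopy 2 s [⟨2, Piece.cup⟩, ⟨1, Piece.cup⟩, ⟨2, Piece.box 2 s x⟩] _ _ []
    (Move.exchange 0 1 Piece.cap Piece.cap)
    (by simp [IsTangle, Piece.bot, Piece.top, Piece.Fits, shadeAt])
    (by simp [IsTangle, Piece.bot, Piece.top, Piece.Fits, shadeAt])
  have e2 := PA.isotopy 2 s [⟨2, Piece.cup⟩, ⟨1, Piece.cup⟩] _ _ [⟨1, Piece.cap⟩]
    (Move.exchange 0 0 Piece.cap (Piece.box 2 s x))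
    (by simp [IsTangle, Piece.bot, Piece.top, Piece.Fits, shadeAt])
    (by simp [IsTangle, Piece.bot, Piece.top, Piece.Fits, shadeAt])
  have e3 := PA.isotopy 2 s [⟨2, Piece.cup⟩] _ _ [⟨0, Piece.box 2 s x⟩, ⟨1, Piece.cap⟩]
    (Move.zigzag_right 0)
    (by simp [IsTangle, Piece.bot, Piece.top, Piece.Fits, shadeAt])
    (by simp [IsTangle, Piece.bot, Piece.top, Piece.Fits, shadeAt])
  have e4 := PA.isotopy 2 s [] _ _ [⟨1, Piece.cap⟩]
    (Move.exchange 0 0 (Piece.box 2 s x) Piece.cup)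
    (by simp [IsTangle, Piece.bot, Piece.top, Piece.Fits, shadeAt])
    (by simp [IsTangle, Piece.bot, Piece.top, Piece.Fits, shadeAt])
  have e5 := PA.isotopy 2 s [⟨0, Piece.box 2 s x⟩] _ _ [] (Move.zigzag_right 1)
    (by simp [IsTangle, Piece.bot, Piece.top, Piece.Fits, shadeAt])
    (by simp [IsTangle, Piece.bot, Piece.top, Piece.Fits, shadeAt])
  exact e0.trans (e1.symm.trans (e2.symm.trans (e3.trans (e4.symm.trans
    (e5.trans (PA.identity 2 s x))))))

theorem fourier_fourierInv (w : P 2 (!s)) : PA.fourier (PA.fourierInv w) = w := by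
  have e0 := PA.gluing 2 (!s) [⟨0, Piece.cup⟩] [⟨2, Piece.cap⟩]
    [⟨2, Piece.cup⟩, ⟨1, Piece.box 2 (!s) w⟩, ⟨0, Piece.cap⟩] 1 2 s
    (by simp [IsTangle, Piece.bot, Piece.top, Piece.Fits, shadeAt])
    (by simp [IsTangle, Piece.bot, Piece.top, Piece.Fits, shadeAt])
  have e1 := PA.isotopy 2 (!s) [] _ _ [⟨2, Piece.box 2 (!s) w⟩, ⟨1, Piece.cap⟩, ⟨2, Piece.cap⟩]
    (Move.exchange 0 1 Piece.cup Piece.cup)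
    (by simp [IsTangle, Piece.bot, Piece.top, Piece.Fits, shadeAt])
    (by simp [IsTangle, Piece.bot, Piece.top, Piece.Fits, shadeAt])
  have e2 := PA.isotopy 2 (!s) [⟨1, Piece.cup⟩] _ _ [⟨1, Piece.cap⟩, ⟨2, Piece.cap⟩]
    (Move.exchange 0 0 Piece.cup (Piece.box 2 (!s) w))
    (by simp [IsTangle, Piece.bot, Piece.top, Piece.Fits, shadeAt])
    (by simp [IsTangle, Piece.bot, Piece.top, Piece.Fits, shadeAt])
  have e3 := PA.isotopy 2 (!s) [⟨1, Piece.cup⟩, ⟨0, Piece.box 2 (!s) w⟩] _ _ [⟨2, Piece.cap⟩]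
    (Move.zigzag_left 0)
    (by simp [IsTangle, Piece.bot, Piece.top, Piece.Fits, shadeAt])
    (by simp [IsTangle, Piece.bot, Piece.top, Piece.Fits, shadeAt])
  have e4 := PA.isotopy 2 (!s) [⟨1, Piece.cup⟩] _ _ []
    (Move.exchange 0 0 (Piece.box 2 (!s) w) Piece.cap)
    (by simp [IsTangle, Piece.bot, Piece.top, Piece.Fits, shadeAt])
    (by simp [IsTangle, Piece.bot, Piece.top, Piece.Fits, shadeAt])
  have e5 := PA.isotopy 2 (!s) [] _ _ [⟨0, Piece.box 2 (!s) w⟩] (Move.zigzag_left 1)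
    (by simp [IsTangle, Piece.bot, Piece.top, Piece.Fits, shadeAt])
    (by simp [IsTangle, Piece.bot, Piece.top, Piece.Fits, shadeAt])
  exact e0.trans (e1.trans (e2.trans (e3.trans (e4.trans
    (e5.trans (PA.identity 2 (!s) w))))))

/-- The Fourier transform turns products into convolutions. -/
theorem fourier_mul (v x : P 2 s) :
    PA.fourier (v * x) = PA.convTwo (PA.fourier v) (PA.fourier x) := by
  have f0 := PA.gluing 2 (!s) [⟨0, Piece.cup⟩] [⟨2, Piece.cap⟩]
    [⟨0, Piece.box 2 s v⟩, ⟨0, Piece.box 2 s x⟩] 1 2 s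
    (by simp [IsTangle, Piece.bot, Piece.top, Piece.Fits, shadeAt])
    (by simp [IsTangle, Piece.bot, Piece.top, Piece.Fits, shadeAt])
  rw [PA.Z_mul] at f0
  have e0 := PA.gluing 2 (!s) [⟨1, Piece.cup⟩]
    [⟨2, Piece.box 2 (!s) (PA.fourier x)⟩, ⟨1, Piece.cap⟩]
    [⟨0, Piece.cup⟩, ⟨1, Piece.box 2 s v⟩, ⟨2, Piece.cap⟩] 0 2 (!s)
    (by simp [IsTangle, Piece.bot, Piece.top, Piece.Fits, shadeAt])
    (by simp [IsTangle, Piece.bot, Piece.top, Piece.Fits, shadeAt])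
  have e1 := PA.gluing 2 (!s) [⟨1, Piece.cup⟩, ⟨0, Piece.cup⟩, ⟨1, Piece.box 2 s v⟩, ⟨2, Piece.cap⟩]
    [⟨1, Piece.cap⟩]
    [⟨0, Piece.cup⟩, ⟨1, Piece.box 2 s x⟩, ⟨2, Piece.cap⟩] 2 2 (!s)
    (by simp [IsTangle, Piece.bot, Piece.top, Piece.Fits, shadeAt])
    (by simp [IsTangle, Piece.bot, Piece.top, Piece.Fits, shadeAt])
  -- The joined strings contain two zigzags, removed in `e4` and `e7`; the other moves only bring
  -- their minima and maxima to adjacent heights.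
  have e2 := PA.isotopy 2 (!s) [⟨1, Piece.cup⟩, ⟨0, Piece.cup⟩, ⟨1, Piece.box 2 s v⟩,
    ⟨2, Piece.cap⟩, ⟨2, Piece.cup⟩, ⟨3, Piece.box 2 s x⟩] _ _ []
    (Move.exchange 1 1 Piece.cap Piece.cap)
    (by simp [IsTangle, Piece.bot, Piece.top, Piece.Fits, shadeAt])
    (by simp [IsTangle, Piece.bot, Piece.top, Piece.Fits, shadeAt])
  have e3 := PA.isotopy 2 (!s) [⟨1, Piece.cup⟩, ⟨0, Piece.cup⟩, ⟨1, Piece.box 2 s v⟩,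
    ⟨2, Piece.cap⟩, ⟨2, Piece.cup⟩] _ _ [⟨2, Piece.cap⟩]
    (Move.exchange 1 0 Piece.cap (Piece.box 2 s x))
    (by simp [IsTangle, Piece.bot, Piece.top, Piece.Fits, shadeAt])
    (by simp [IsTangle, Piece.bot, Piece.top, Piece.Fits, shadeAt])
  have e4 := PA.isotopy 2 (!s) [⟨1, Piece.cup⟩, ⟨0, Piece.cup⟩, ⟨1, Piece.box 2 s v⟩,
    ⟨2, Piece.cap⟩] _ _ [⟨1, Piece.box 2 s x⟩, ⟨2, Piece.cap⟩]
    (Move.zigzag_right 1)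
    (by simp [IsTangle, Piece.bot, Piece.top, Piece.Fits, shadeAt])
    (by simp [IsTangle, Piece.bot, Piece.top, Piece.Fits, shadeAt])
  have e5 := PA.isotopy 2 (!s) [] _ _ [⟨1, Piece.box 2 s v⟩,
    ⟨2, Piece.cap⟩, ⟨1, Piece.box 2 s x⟩, ⟨2, Piece.cap⟩]
    (Move.exchange 0 1 Piece.cup Piece.cup)
    (by simp [IsTangle, Piece.bot, Piece.top, Piece.Fits, shadeAt])
    (by simp [IsTangle, Piece.bot, Piece.top, Piece.Fits, shadeAt])
  have e6 := PA.isotopy 2 (!s) [⟨0, Piece.cup⟩] _ _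
    [⟨2, Piece.cap⟩, ⟨1, Piece.box 2 s x⟩, ⟨2, Piece.cap⟩]
    (Move.exchange 1 0 (Piece.box 2 s v) Piece.cup)
    (by simp [IsTangle, Piece.bot, Piece.top, Piece.Fits, shadeAt])
    (by simp [IsTangle, Piece.bot, Piece.top, Piece.Fits, shadeAt])
  have e7 := PA.isotopy 2 (!s) [⟨0, Piece.cup⟩, ⟨1, Piece.box 2 s v⟩] _ _
    [⟨1, Piece.box 2 s x⟩, ⟨2, Piece.cap⟩]
    (Move.zigzag_right 2)
    (by simp [IsTangle, Piece.bot, Piece.top, Piece.Fits, shadeAt])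
    (by simp [IsTangle, Piece.bot, Piece.top, Piece.Fits, shadeAt])
  exact f0.trans (e0.trans (e1.trans (e2.symm.trans (e3.symm.trans (e4.trans
    (e5.symm.trans (e6.symm.trans e7))))))).symm

end CStarPlanarAlgebra
end PlanarAlg

/-! ### Perron–Frobenius theory for irreducible positive maps. Strict positivity is expressed by `ε
• 1 ≤ y` with `0 < ε`. -/

section PerronFrobenius

variable {A : Type*} [CStarAlgebra A] [PartialOrder A] [StarOrderedRing A]

theorem IsSelfAdjoint.le_norm_smul_one {h : A} (hh : IsSelfAdjoint h) : h ≤ ‖h‖ • (1 : A) := by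
  rw [← Algebra.algebraMap_eq_smul_one]
  exact hh.le_algebraMap_norm_self

theorem IsSelfAdjoint.le_smul_of_smul_one_le {h y : A} (hh : IsSelfAdjoint h) {ε : ℝ} (hε : 0 < ε)
    (hy : ε • (1 : A) ≤ y) : h ≤ (‖h‖ / ε) • y := by
  calc h ≤ ‖h‖ • (1 : A) := hh.le_norm_smul_one
    _ = (‖h‖ / ε) • (ε • (1 : A)) := by rw [smul_smul, div_mul_cancel₀ _ hε.ne']
    _ ≤ (‖h‖ / ε) • y := smul_le_smul_of_nonneg_left hy (by positivity)

theorem nonneg_of_smul_one_le {y : A} {ε : ℝ} (hε : 0 < ε) (hy : ε • (1 : A) ≤ y) : 0 ≤ y :=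
  (smul_nonneg hε.le zero_le_one).trans hy

theorem ne_zero_of_smul_one_le [Nontrivial A] {y : A} {ε : ℝ} (hε : 0 < ε)
    (hy : ε • (1 : A) ≤ y) : y ≠ 0 := by
  rintro rfl
  have h0 : ε • (1 : A) = 0 := le_antisymm hy (smul_nonneg hε.le zero_le_one)
  rcases smul_eq_zero.1 h0 with h | h
  · exact hε.ne' h
  · exact one_ne_zero h

theorem isUnit_of_smul_one_le {y : A} {ε : ℝ} (hε : 0 < ε) (hy : ε • (1 : A) ≤ y) : IsUnit y := by
  refine CStarAlgebra.isUnit_of_le (ε • (1 : A)) hy ⟨smul_nonneg hε.le zero_le_one, ?_⟩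
  rw [← Algebra.algebraMap_eq_smul_one]
  exact (IsUnit.mk0 _ hε.ne').map _

/-- In finite dimension, a positive element is comparable with its support projection. -/
theorem exists_support_projection [FiniteDimensional ℂ A] {y : A} (hy : 0 ≤ y) :
    ∃ p : A, IsStarProjection p ∧ (∃ ε : ℝ, 0 < ε ∧ ε • p ≤ y) ∧ ∃ C : ℝ, 0 < C ∧ y ≤ C • p := by
  have : FiniteDimensional ℝ A := FiniteDimensional.complexToReal _
  have hc := continuousOn_spectrum_of_finiteDimensional y
  have hfin := spectrum_finite_of_finiteDimensional (K := ℝ) y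
  have hsa : IsSelfAdjoint y := .of_nonneg hy
  set f : ℝ → ℝ := fun t => if t = 0 then 0 else 1 with hf
  have hnn : ∀ t ∈ spectrum ℝ y, 0 ≤ t := fun t ht => spectrum_nonneg_of_nonneg hy ht
  refine ⟨cfc f y, ⟨?_, cfc_predicate _ _⟩, ?_, ‖y‖ + 1, by positivity, ?_⟩
  · rw [IsIdempotentElem, ← cfc_mul f f y (hc _) (hc _)]
    refine cfc_congr fun t _ => ?_
    by_cases h : t = 0 <;> simp [hf, h]
  · obtain ⟨ε, hε, hle⟩ : ∃ ε : ℝ, 0 < ε ∧ ∀ t ∈ spectrum ℝ y, t ≠ 0 → ε ≤ t := by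
      rcases (spectrum ℝ y \ {0}).eq_empty_or_nonempty with he | hne
      · exact ⟨1, one_pos, fun t ht h0 => absurd (Set.mem_sdiff_singleton.2 ⟨ht, h0⟩) (he ▸ Set.notMem_empty t)⟩
      · obtain ⟨a, ⟨ha, ha0⟩, hmin⟩ := (hfin.subset Set.sdiff_subset).exists_minimalFor id _ hne |>.imp
          fun a h => h
        exact ⟨a, (hnn a ha).lt_of_ne (Ne.symm ha0), fun t ht h0 => by
          rcases le_total a t with h | h
          · exact h
          · exact hmin ⟨ht, h0⟩ h⟩
    refine ⟨ε, hε, ?_⟩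
    rw [← cfc_smul ε f y (hc _)]
    conv_rhs => rw [← cfc_id' ℝ y]
    refine cfc_mono (fun t ht => ?_) (hc _) (hc _)
    by_cases h : t = 0
    · simp [hf, h]
    · simpa [hf, h] using hle t ht h
  · rw [← cfc_smul _ f y (hc _)]
    conv_lhs => rw [← cfc_id' ℝ y]
    refine cfc_mono (fun t ht => ?_) (hc _) (hc _)
    by_cases h : t = 0
    · simp [hf, h]
    · have hnt : Nontrivial A := by
        by_contra hn
        rw [not_nontrivial_iff_subsingleton] at hn
        rw [spectrum.of_subsingleton] at ht
        exact ht
      have := (Real.le_norm_self t).trans (spectrum.norm_le_norm_of_mem ht)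
      simp only [hf, h, if_false, smul_eq_mul, mul_one]
      linarith

variable {T : A →ₗ[ℂ] A}

/-- A positive linear map is irreducible if it leaves no proper face of the positive cone
invariant. -/
def IrreduciblePositive (T : A →ₗ[ℂ] A) : Prop :=
  ∀ p : A, IsStarProjection p → ∀ c : ℝ, 0 < c → T p ≤ c • p → p = 0 ∨ p = 1

theorem map_mono_of_nonneg (hT : ∀ a, 0 ≤ a → 0 ≤ T a) {a b : A} (h : a ≤ b) : T a ≤ T b := by
  have := hT _ (sub_nonneg.2 h)
  rwa [map_sub, sub_nonneg] at this

theorem map_star_of_nonneg (hT : ∀ a, 0 ≤ a → 0 ≤ T a) (a : A) : T (star a) = star (T a) := by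
  obtain ⟨x, hx, -, rfl⟩ := CStarAlgebra.exists_sum_four_nonneg a
  simp only [map_sum, map_smul, star_sum, star_smul]
  refine Finset.sum_congr rfl fun i _ => ?_
  rw [(IsSelfAdjoint.of_nonneg (hx i)).star_eq, (IsSelfAdjoint.of_nonneg (hT _ (hx i))).star_eq]

/-- A nonzero subinvariant element of an irreducible positive map is strictly positive. -/
theorem IrreduciblePositive.exists_smul_one_le [FiniteDimensional ℂ A]
    (hirr : IrreduciblePositive T) (hT : ∀ a, 0 ≤ a → 0 ≤ T a) {y : A} (hy : 0 ≤ y) (hy0 : y ≠ 0)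
    {c : ℝ} (hc : 0 < c) (h : T y ≤ c • y) : ∃ ε : ℝ, 0 < ε ∧ ε • (1 : A) ≤ y := by
  obtain ⟨p, hp, ⟨ε, hε, h1⟩, C, hC, h2⟩ := exists_support_projection hy
  -- The support projection `p` inherits subinvariance from `y`, since each is bounded by a multiple
  -- of the other.
  have hTp : T p ≤ (ε⁻¹ * (c * C)) • p := by
    calc T p = ε⁻¹ • T (ε • p) := by
          rw [T.map_smul_of_tower, smul_smul, inv_mul_cancel₀ hε.ne', one_smul]
      _ ≤ ε⁻¹ • (c • C • p) := smul_le_smul_of_nonneg_left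
          (((map_mono_of_nonneg hT h1).trans h).trans (smul_le_smul_of_nonneg_left h2 hc.le))
          (inv_pos.2 hε).le
      _ = _ := by simp only [smul_smul]
  rcases hirr p hp _ (by positivity) hTp with rfl | rfl
  · rw [smul_zero] at h2
    exact absurd (le_antisymm h2 hy) hy0
  · exact ⟨ε, hε, h1⟩

/-- The resolvent of a positive map outside a large disc. -/
theorem exists_positive_resolvent [FiniteDimensional ℂ A] (hT : ∀ a, 0 ≤ a → 0 ≤ T a) :
    ∃ (R : A →ₗ[ℂ] A) (c : ℝ), 0 < c ∧ (∀ a, T (R a) = R (T a)) ∧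
      ∀ a, 0 ≤ a → a ≤ R a ∧ T (R a) ≤ c • R a := by
  set L : A →L[ℂ] A := LinearMap.toContinuousLinearMap T with hL
  have hLT : ∀ a, L a = T a := fun a => rfl
  -- With `d` above the norm, the Neumann series `R = ∑ (T / d)ⁿ` converges; it satisfies `T (R a) =
  -- d • (R a - a)`.
  set d : ℝ := ‖L‖ + 1 with hd
  have hd0 : 0 < d := by positivity
  set B : A →L[ℂ] A := ((d⁻¹ : ℝ) : ℂ) • L with hB
  have hB1 : ‖B‖ < 1 := by
    rw [hB, norm_smul, Complex.norm_real, Real.norm_of_nonneg (inv_pos.2 hd0).le,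
      inv_mul_lt_iff₀ hd0]
    linarith
  have hBT : ∀ a, B a = d⁻¹ • T a := fun a => by
    rw [hB, smul_apply, hLT, Complex.coe_smul]
  set R : A →L[ℂ] A := ∑' n : ℕ, B ^ n with hR
  have hl := mul_neg_geom_series B hB1
  have hr := geom_series_mul_neg B hB1
  have hRB : ∀ a, B (R a) = R a - a := fun a => by
    have := congrArg (fun F : A →L[ℂ] A => F a) hl
    simp only [mul_apply_eq_comp, sub_apply,
      one_apply_eq_self] at this
    rw [← hR] at this
    exact eq_sub_of_add_eq (sub_eq_iff_eq_add'.1 this).symm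
  have hBR : ∀ a, R (B a) = R a - a := fun a => by
    have := congrArg (fun F : A →L[ℂ] A => F a) hr
    simp only [mul_apply_eq_comp, sub_apply,
      one_apply_eq_self, map_sub] at this
    rw [← hR] at this
    exact eq_sub_of_add_eq (sub_eq_iff_eq_add'.1 this).symm
  have hTd : ∀ a, T a = d • B a := fun a => by
    rw [hBT, smul_smul, mul_inv_cancel₀ hd0.ne', one_smul]
  have hRpos : ∀ a, 0 ≤ a → 0 ≤ R a := fun a ha => by
    have hs := summable_geometric_of_norm_lt_one hB1
    have h1 : HasSum (fun n : ℕ => (B ^ n) a) (R a) := by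
      have := (ContinuousLinearMap.apply ℂ A a).hasSum hs.hasSum
      exact this
    refine h1.nonneg fun n => ?_
    induction n with
    | zero => simpa using ha
    | succ n ih =>
      rw [pow_succ', mul_apply_eq_comp, hBT]
      exact smul_nonneg (inv_pos.2 hd0).le (hT _ ih)
  refine ⟨R.toLinearMap, d, hd0, fun a => ?_, fun a ha => ⟨?_, ?_⟩⟩
  · change T (R a) = R (T a)
    rw [hTd, hTd, hRB, ← hBR]
    exact ((R.toLinearMap).map_smul_of_tower d (B a)).symm
  · change a ≤ R a
    rw [← sub_nonneg, ← hBR, hBT]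
    exact hRpos _ (smul_nonneg (inv_pos.2 hd0).le (hT _ ha))
  · change T (R a) ≤ d • R a
    rw [hTd, hRB]
    exact smul_le_smul_of_nonneg_left (sub_le_self _ ha) hd0.le

/-- Existence of the Perron–Frobenius eigenvector. -/
theorem IrreduciblePositive.exists_eigenvector [FiniteDimensional ℂ A] [Nontrivial A]
    (hirr : IrreduciblePositive T) (hT : ∀ a, 0 ≤ a → 0 ≤ T a) :
    ∃ (r : ℝ) (y : A) (ε : ℝ), 0 ≤ r ∧ 0 < ε ∧ ε • (1 : A) ≤ y ∧ T y = r • y := by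
  have : FiniteDimensional ℝ A := FiniteDimensional.complexToReal _
  have hprop : ProperSpace A := FiniteDimensional.proper ℝ A
  set L : A →L[ℂ] A := LinearMap.toContinuousLinearMap T with hL
  have hLT : ∀ a, L a = T a := fun a => rfl
  -- Collatz–Wielandt: the eigenvalue is the largest `t` with `t • y ≤ T y` for some positive unit
  -- vector `y`; it is attained by compactness.
  set K : Set (ℝ × A) := {q | 0 ≤ q.1 ∧ 0 ≤ q.2 ∧ ‖q.2‖ = 1 ∧ q.1 • q.2 ≤ L q.2} with hK
  have hKb : K ⊆ Set.Icc 0 ‖L‖ ×ˢ Metric.closedBall 0 1 := by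
    rintro ⟨t, y⟩ ⟨h1, h2, h3, h4⟩
    dsimp at h1 h2 h3 h4
    refine ⟨⟨h1, ?_⟩, by simp [h3]⟩
    have := CStarAlgebra.norm_le_norm_of_nonneg_of_le (smul_nonneg h1 h2) h4
    rw [norm_smul, h3, Real.norm_of_nonneg h1, mul_one] at this
    simpa [h3] using this.trans (L.le_opNorm y)
  have hKc : IsClosed K := by
    refine (isClosed_le continuous_const continuous_fst).inter
      ((isClosed_le continuous_const continuous_snd).inter
      ((isClosed_eq continuous_snd.norm continuous_const).inter (isClosed_le ?_ ?_)))
    · exact continuous_fst.smul continuous_snd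
    · exact L.continuous.comp continuous_snd
  have hKk : IsCompact K := (isCompact_Icc.prod (isCompact_closedBall _ _)).of_isClosed_subset hKc hKb
  have hKn : K.Nonempty := ⟨(0, 1), le_rfl, zero_le_one, by simp, by
    simpa [hLT] using hT 1 zero_le_one⟩
  obtain ⟨⟨r, y⟩, ⟨hr, hy, hy1, hry⟩, hmax⟩ := hKk.exists_isMaxOn hKn continuous_fst.continuousOn
  dsimp only at hr hy hy1 hry
  rw [hLT] at hry
  have hy0 : y ≠ 0 := by rintro rfl; simp at hy1
  have heig : T y = r • y := by
    by_contra hne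
    -- A nonzero defect `T y - r • y` becomes strictly positive under `R`, because its image is
    -- subinvariant. As `R` commutes with `T`, the vector `R y` then admits a value larger than `r`.
    obtain ⟨R, c, hc, hcomm, hR⟩ := exists_positive_resolvent hT
    have hz : 0 ≤ T y - r • y := sub_nonneg.2 hry
    have hz0 : T y - r • y ≠ 0 := sub_ne_zero.2 hne
    have hRz0 : R (T y - r • y) ≠ 0 := fun h0 => hz0 (le_antisymm (h0 ▸ (hR _ hz).1) hz)
    obtain ⟨ε, hε, hle⟩ := hirr.exists_smul_one_le hT (hz.trans (hR _ hz).1) hRz0 hc (hR _ hz).2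
    rw [map_sub, ← hcomm, R.map_smul_of_tower] at hle
    have hRy := hy.trans (hR y hy).1
    have hRy0 : R y ≠ 0 := fun h0 => hy0 (le_antisymm (h0 ▸ (hR y hy).1) hy)
    have hn : 0 < ‖R y‖ := norm_pos_iff.2 hRy0
    have h1 : (r + ε / ‖R y‖) • R y ≤ T (R y) := by
      have h2 : (ε / ‖R y‖) • R y ≤ ε • (1 : A) := by
        calc (ε / ‖R y‖) • R y ≤ (ε / ‖R y‖) • (‖R y‖ • (1 : A)) :=
              smul_le_smul_of_nonneg_left (IsSelfAdjoint.of_nonneg hRy).le_norm_smul_one (by positivity)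
          _ = ε • (1 : A) := by rw [smul_smul, div_mul_cancel₀ _ hn.ne']
      rw [add_smul, ← le_sub_iff_add_le']
      exact h2.trans hle
    have hmem : (r + ε / ‖R y‖, ‖R y‖⁻¹ • R y) ∈ K := by
      refine ⟨by dsimp; positivity, smul_nonneg (by positivity) hRy, ?_, ?_⟩
      · simp [norm_smul, inv_mul_cancel₀ hn.ne']
      · dsimp only
        rw [hLT, T.map_smul_of_tower, smul_comm]
        exact smul_le_smul_of_nonneg_left h1 (by positivity)
    have := hmax hmem
    simp only [Set.mem_ofPred_eq] at this
    have hpos : 0 < ε / ‖R y‖ := by positivity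
    linarith
  -- The factor must be positive while `r` may be zero, hence `r + 1`.
  obtain ⟨ε, hε, hle⟩ := hirr.exists_smul_one_le hT hy hy0 (c := r + 1) (by linarith)
    (by rw [heig, add_smul, one_smul]; exact le_add_of_nonneg_right hy)
  exact ⟨r, y, ε, hr, hε, hle, heig⟩

/-- Uniqueness of the Perron–Frobenius eigenvector among self-adjoint elements. -/
theorem IrreduciblePositive.exists_eq_smul_of_isSelfAdjoint [FiniteDimensional ℂ A]
    (hirr : IrreduciblePositive T) (hT : ∀ a, 0 ≤ a → 0 ≤ T a) {r : ℝ} (hr : 0 ≤ r) {y : A} {ε : ℝ}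
    (hε : 0 < ε) (hy : ε • (1 : A) ≤ y) (hTy : T y = r • y) {h : A} (hh : IsSelfAdjoint h)
    (hTh : T h = r • h) : ∃ t : ℝ, h = t • y := by
  rcases subsingleton_or_nontrivial A with hs | hnt
  · exact ⟨0, Subsingleton.elim _ _⟩
  have hy0 := nonneg_of_smul_one_le hε hy
  have hyne := ne_zero_of_smul_one_le hε hy
  have hyn : 0 < ‖y‖ := norm_pos_iff.2 hyne
  -- For the least `t` in `S`, the element `t • y - h` is a positive eigenvector. Were it nonzero,
  -- it would be strictly positive and `t` could be lowered.
  set S : Set ℝ := {t | h ≤ t • y} with hS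
  have hSc : IsClosed S := isClosed_le continuous_const (continuous_id.smul continuous_const)
  have hSn : S.Nonempty := ⟨_, hh.le_smul_of_smul_one_le hε hy⟩
  have hSb : BddBelow S := by
    refine ⟨-(‖h‖ / ε), fun t ht => ?_⟩
    by_contra hlt
    have h1 := hh.neg.le_smul_of_smul_one_le hε hy
    rw [norm_neg] at h1
    have h2 : 0 ≤ (t + ‖h‖ / ε) • y := by
      have := add_le_add (show h ≤ t • y from ht) h1
      rwa [add_neg_cancel, ← add_smul] at this
    have h3 : 0 < -(t + ‖h‖ / ε) := by linarith [not_le.1 hlt]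
    have h4 : (-(t + ‖h‖ / ε)) • y ≤ 0 := by rwa [neg_smul, neg_nonpos]
    have h5 := le_antisymm h4 (smul_nonneg h3.le hy0)
    rcases smul_eq_zero.1 h5 with h6 | h6
    · exact h3.ne' h6
    · exact hyne h6
  have hmem := hSc.csInf_mem hSn hSb
  set t := sInf S with ht
  refine ⟨t, ?_⟩
  by_contra hne
  have hz : 0 ≤ t • y - h := sub_nonneg.2 hmem
  have hz0 : t • y - h ≠ 0 := sub_ne_zero.2 (Ne.symm hne)
  have hTz : T (t • y - h) = r • (t • y - h) := by
    rw [map_sub, T.map_smul_of_tower, hTy, hTh, smul_sub, smul_comm]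
  obtain ⟨δ, hδ, hle⟩ := hirr.exists_smul_one_le hT hz hz0 (c := r + 1) (by linarith)
    (by rw [hTz, add_smul, one_smul]; exact le_add_of_nonneg_right hz)
  have hle2 : (δ / ‖y‖) • y ≤ t • y - h := by
    refine le_trans ?_ hle
    calc (δ / ‖y‖) • y ≤ (δ / ‖y‖) • (‖y‖ • (1 : A)) :=
          smul_le_smul_of_nonneg_left (IsSelfAdjoint.of_nonneg hy0).le_norm_smul_one (by positivity)
      _ = δ • (1 : A) := by rw [smul_smul, div_mul_cancel₀ _ hyn.ne']
  have hmem2 : t - δ / ‖y‖ ∈ S := by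
    change h ≤ (t - δ / ‖y‖) • y
    rw [sub_smul]
    exact le_sub_comm.1 hle2
  have := csInf_le hSb hmem2
  have hpos : 0 < δ / ‖y‖ := by positivity
  linarith

/-- Uniqueness of the Perron–Frobenius eigenvector. -/
theorem IrreduciblePositive.exists_eq_smul [FiniteDimensional ℂ A]
    (hirr : IrreduciblePositive T) (hT : ∀ a, 0 ≤ a → 0 ≤ T a) {r : ℝ} (hr : 0 ≤ r) {y : A} {ε : ℝ}
    (hε : 0 < ε) (hy : ε • (1 : A) ≤ y) (hTy : T y = r • y) {v : A} (hv : T v = r • v) :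
    ∃ c : ℂ, v = c • y := by
  have hsv : T (star v) = r • star v := by
    rw [map_star_of_nonneg hT, hv, star_smul, star_trivial]
  -- Since `r` is real, the real and imaginary parts of `v` are eigenvectors as well, up to scalar
  -- factors.
  have h1 : T (v + star v) = r • (v + star v) := by rw [map_add, hv, hsv, smul_add]
  have h2 : T (Complex.I • (v - star v)) = r • (Complex.I • (v - star v)) := by
    rw [map_smul, map_sub, hv, hsv, ← smul_sub, smul_comm]
  obtain ⟨a, ha⟩ := hirr.exists_eq_smul_of_isSelfAdjoint hT hr hε hy hTy
    (show IsSelfAdjoint (v + star v) by simp [IsSelfAdjoint, add_comm]) h1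
  obtain ⟨b, hb⟩ := hirr.exists_eq_smul_of_isSelfAdjoint hT hr hε hy hTy
    (show IsSelfAdjoint (Complex.I • (v - star v)) by
      simp [IsSelfAdjoint, star_smul, ← smul_neg]) h2
  refine ⟨(1 / 2 : ℂ) * (a - Complex.I * b), ?_⟩
  have e : v = (1 / 2 : ℂ) • ((v + star v) - Complex.I • (Complex.I • (v - star v))) := by
    rw [smul_smul, Complex.I_mul_I]
    module
  rw [ha, hb, ← Complex.coe_smul, ← Complex.coe_smul] at e
  rw [e]
  module

/-- If a positive map has a strictly positive eigenvector, then its eigenvalue dominates all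
eigenvalues. -/
theorem norm_eigenvalue_le (hT : ∀ a, 0 ≤ a → 0 ≤ T a) {r : ℝ} (hr : 0 ≤ r) {y : A} {ε : ℝ}
    (hε : 0 < ε) (hy : ε • (1 : A) ≤ y) (hTy : T y = r • y) {μ : ℂ} {v : A} (hv0 : v ≠ 0)
    (hv : T v = μ • v) : ‖μ‖ ≤ r := by
  have hTny : ∀ n : ℕ, (T ^ n) y = r ^ n • y := fun n => by
    induction n with
    | zero => simp
    | succ n ih => rw [pow_succ', Module.End.mul_apply, ih, T.map_smul_of_tower, hTy, smul_smul, pow_succ]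
  have hTnv : ∀ n : ℕ, (T ^ n) v = μ ^ n • v := fun n => by
    induction n with
    | zero => simp
    | succ n ih => rw [pow_succ', Module.End.mul_apply, ih, map_smul, hv, smul_smul, pow_succ]
  have hTn : ∀ (n : ℕ) (a : A), 0 ≤ a → 0 ≤ (T ^ n) a := fun n a ha => by
    induction n with
    | zero => simpa using ha
    | succ n ih => rw [pow_succ', Module.End.mul_apply]; exact hT _ ih
  -- A positive `a` lies below a multiple of `y`, so its iterates grow no faster than `r ^ n`. By
  -- decomposition into four positive elements, the same rate holds for `v`.
  have hpos : ∀ (n : ℕ) (a : A), 0 ≤ a → ‖(T ^ n) a‖ ≤ ‖a‖ / ε * ‖y‖ * r ^ n := fun n a ha => by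
    have h1 := map_mono_of_nonneg (hTn n) ((IsSelfAdjoint.of_nonneg ha).le_smul_of_smul_one_le hε hy)
    rw [LinearMap.map_smul_of_tower, hTny] at h1
    have h2 := CStarAlgebra.norm_le_norm_of_nonneg_of_le (hTn n a ha) h1
    rw [norm_smul, norm_smul, Real.norm_of_nonneg (by positivity), Real.norm_of_nonneg (by positivity)] at h2
    linarith
  obtain ⟨x, hx, -, hsum⟩ := CStarAlgebra.exists_sum_four_nonneg v
  set C : ℝ := ∑ i, ‖x i‖ / ε * ‖y‖ with hC
  have hbound : ∀ n : ℕ, ‖μ‖ ^ n * ‖v‖ ≤ C * r ^ n := fun n => by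
    rw [← norm_pow, ← norm_smul, ← hTnv, hsum, map_sum, hC, Finset.sum_mul]
    refine (norm_sum_le _ _).trans (Finset.sum_le_sum fun i _ => ?_)
    rw [map_smul, norm_smul]
    simpa using hpos n _ (hx i)
  by_contra hlt
  have hμ : 0 < ‖μ‖ := hr.trans_lt (not_le.1 hlt)
  have hlim := (tendsto_pow_atTop_nhds_zero_of_lt_one (div_nonneg hr hμ.le)
    ((div_lt_one hμ).2 (not_le.1 hlt))).const_mul C
  have hle : ∀ n : ℕ, ‖v‖ ≤ C * (r / ‖μ‖) ^ n := fun n => by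
    rw [div_pow, ← mul_div_assoc, le_div_iff₀ (by positivity), mul_comm]
    exact hbound n
  have := ge_of_tendsto' hlim hle
  rw [mul_zero] at this
  exact hv0 (norm_le_zero_iff.1 this)

end PerronFrobenius

/-! ### The spectrum as the eigenvalues of right multiplication. -/

section LeftEigenvectors

variable {K A : Type*} [Field K] [Ring A] [Algebra K A]

theorem mem_spectrum_of_mul_eq_smul {x v : A} {μ : K} (hv : v ≠ 0) (h : v * x = μ • v) :
    μ ∈ spectrum K x := by
  intro hu
  refine hv (hu.mul_left_eq_zero.1 ?_)
  rw [mul_sub, h, ← Algebra.commutes, Algebra.smul_def, sub_self]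

/-- If right multiplication by `μ - x` were injective, it would be surjective in finite dimension,
and `μ - x` would be invertible. -/
theorem exists_mul_eq_smul_of_mem_spectrum [FiniteDimensional K A] {x : A} {μ : K}
    (hμ : μ ∈ spectrum K x) : ∃ v : A, v ≠ 0 ∧ v * x = μ • v := by
  by_contra! hcon
  set z := algebraMap K A μ - x with hz
  have hinj : Function.Injective (LinearMap.mulRight K z) := by
    rw [← LinearMap.ker_eq_bot, LinearMap.ker_eq_bot']
    intro v hv
    by_contra hv0
    refine hcon v hv0 ?_
    rw [LinearMap.mulRight_apply, hz, mul_sub, sub_eq_zero, ← Algebra.commutes,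
      ← Algebra.smul_def] at hv
    exact hv.symm
  obtain ⟨c, hc⟩ := LinearMap.surjective_of_injective hinj 1
  rw [LinearMap.mulRight_apply] at hc
  have hc' : z * c = 1 := hinj (by simp [mul_assoc, hc])
  exact hμ ⟨⟨z, c, hc', hc⟩, rfl⟩

end LeftEigenvectors

/-! ### Identification of the eigenvalue with the spectral radius, and the theorem. -/

namespace PlanarAlg
variable {P : ℕ → Bool → Type u} [∀ n s, CStarAlgebra (P n s)]
namespace CStarPlanarAlgebra

variable {PA : CStarPlanarAlgebra P} {s : Bool}

theorem conv_zero (y : P 1 s) : PA.conv y 0 = 0 :=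
  (PA.boxMap 1 s [⟨0, Piece.cup⟩, ⟨0, Piece.box 1 s y⟩] [⟨0, Piece.cap⟩] 1 2 (!s)
    fun _ => by simp [IsTangle, Piece.bot, Piece.top, Piece.Fits, shadeAt]).map_zero

theorem fourier_injective : Function.Injective (PA.fourier (s := s)) :=
  Function.LeftInverse.injective fourierInv_fourier

/-- The eigenvalue of a strictly positive eigenvector of the convolution is the spectral radius. -/
theorem conv_eq_spectralRadius_smul [PartialOrder (P 1 s)] [StarOrderedRing (P 1 s)]
    [PartialOrder (P 2 !s)] [StarOrderedRing (P 2 !s)] {x : P 2 s} (hx : 0 ≤ PA.fourier x)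
    {y : P 1 s} {r ε : ℝ} (hr : 0 ≤ r) (hε : 0 < ε) (hy : ε • (1 : P 1 s) ≤ y)
    (h : PA.conv y (PA.fourier x) = r • y) :
    PA.conv y (PA.fourier x) = (spectralRadius ℂ x).toReal • y := by
  have hfd : FiniteDimensional ℂ (P 2 s) := PA.finiteDimensional 2 s
  -- The `2`-boxes may be zero although the `1`-boxes are not; then both the convolution and the
  -- spectral radius vanish.
  rcases subsingleton_or_nontrivial (P 2 !s) with hs | hnt
  · have : Subsingleton (P 2 s) := (fourier_injective (PA := PA)).subsingleton
    rw [Subsingleton.elim (PA.fourier x) 0, conv_zero, spectrum.SpectralRadius.of_subsingleton]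
    simp
  -- Adding a string preserves the unit and positivity, hence the lower bound.
  have hu : ε • (1 : P 2 !s) ≤ PA.addString s y := by
    have := addString_nonneg (PA := PA) (sub_nonneg.2 hy)
    rwa [map_sub, LinearMap.map_smul_of_tower, addString_one, sub_nonneg] at this
  have hS : PA.convTwoMap (PA.fourier x) (PA.addString s y) = r • PA.addString s y := by
    rw [convTwoMap_apply, convTwo_addString, h, LinearMap.map_smul_of_tower]
  have hspec : spectralRadius ℂ x = ENNReal.ofReal r := by
    refine le_antisymm (iSup₂_le fun μ hμ => ?_) ?_
    -- The Fourier transform of a left eigenvector of `x` is an eigenvector of the convolution on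
    -- `2`-boxes, whose eigenvalues are dominated by `r`.
    · obtain ⟨v, hv0, hv⟩ := exists_mul_eq_smul_of_mem_spectrum hμ
      have hle : ‖μ‖ ≤ r := by
        refine norm_eigenvalue_le (T := PA.convTwoMap (PA.fourier x))
          (fun a ha => convTwo_nonneg ha hx) hr hε hu hS (v := PA.fourier v) (μ := μ) ?_ ?_
        · intro h0
          exact hv0 (fourier_injective (PA := PA) (h0.trans (PA.fourierMap s).map_zero.symm))
        · rw [convTwoMap_apply, ← fourier_mul, hv]
          exact (PA.fourierMap s).map_smul μ v
      rw [← enorm_eq_nnnorm, ← ofReal_norm]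
      exact ENNReal.ofReal_le_ofReal hle
    -- Conversely, the inverse Fourier transform of `y` beside a string is a left eigenvector of `x`
    -- with eigenvalue `r`.
    · have hmem : (r : ℂ) ∈ spectrum ℂ x := by
        refine mem_spectrum_of_mul_eq_smul (v := PA.fourierInv (PA.addString s y)) ?_ ?_
        · intro h0
          refine ne_zero_of_smul_one_le hε hu ?_
          rw [← fourier_fourierInv (PA := PA) (PA.addString s y), h0]
          exact (PA.fourierMap s).map_zero
        · refine fourier_injective (PA := PA) ?_
          rw [fourier_mul, fourier_fourierInv, ← convTwoMap_apply, hS]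
          refine Eq.trans ?_ ((PA.fourierMap s).map_smul (r : ℂ) _).symm
          rw [fourierMap_apply, fourier_fourierInv, Complex.coe_smul]
      have := le_iSup₂ (f := fun (k : ℂ) (_ : k ∈ spectrum ℂ x) => (‖k‖₊ : ENNReal)) (r : ℂ) hmem
      refine le_trans ?_ this
      rw [← enorm_eq_nnnorm, ← ofReal_norm, Complex.norm_real, Real.norm_of_nonneg hr]
  rw [hspec, ENNReal.toReal_ofReal hr, h]

end CStarPlanarAlgebra
end PlanarAlg

theorem theorem3p5 {P : ℕ → Bool → Type u} [∀ n s, CStarAlgebra (P n s)]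
    (PA : PlanarAlg.CStarPlanarAlgebra P) (s : Bool) (x : P 2 s)
    (hx : PA.FPositive x) (hirr : PA.Irreducible x) :
    ∃ y : P 1 s, PlanarAlg.IsStrictlyPositiveElt y ∧ PA.IsPFEigenvector x y ∧
      (∀ y₁ : P 1 s, PlanarAlg.IsStrictlyPositiveElt y₁ → PA.IsPFEigenvector x y₁ →
        ∃ c : ℝ, 0 < c ∧ y₁ = (c : ℂ) • y) ∧
      ∀ y' : P 1 s, PA.IsPFEigenvector x y' → ∃ c : ℂ, y' = c • y := by
  let _ := CStarAlgebra.spectralOrder (P 1 s)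
  have _ := CStarAlgebra.spectralOrderedRing (P 1 s)
  let _ := CStarAlgebra.spectralOrder (P 2 !s)
  have _ := CStarAlgebra.spectralOrderedRing (P 2 !s)
  have hfd : FiniteDimensional ℂ (P 1 s) := PA.finiteDimensional 1 s
  rcases subsingleton_or_nontrivial (P 1 s) with hs | hnt
  -- In the zero algebra `1 = 0` is itself strictly positive.
  · exact ⟨1, ⟨⟨1, Subsingleton.elim _ _⟩, isUnit_one⟩, Subsingleton.elim _ _,
      fun _ _ _ => ⟨1, one_pos, Subsingleton.elim _ _⟩, fun _ _ => ⟨1, Subsingleton.elim _ _⟩⟩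
  have hw : 0 ≤ PA.fourier x := CStarAlgebra.nonneg_iff_eq_mul_star_self.2 hx
  set T := PA.convMap (PA.fourier x) with hTdef
  have hT : ∀ a, 0 ≤ a → 0 ≤ T a := fun a ha => PlanarAlg.CStarPlanarAlgebra.conv_nonneg ha hw
  have hirrT : IrreduciblePositive T := fun p hp c hc hle => by
    refine hirr p hp c hc (CStarAlgebra.nonneg_iff_eq_mul_star_self.1 ?_)
    rw [Complex.coe_smul, sub_nonneg]
    exact hle
  obtain ⟨r, y, ε, hr, hε, hy, hTy⟩ := hirrT.exists_eigenvector hT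
  have hy0 := nonneg_of_smul_one_le hε hy
  have heig := PlanarAlg.CStarPlanarAlgebra.conv_eq_spectralRadius_smul hw hr hε hy hTy
  have hρ : 0 ≤ (spectralRadius ℂ x).toReal := ENNReal.toReal_nonneg
  have hPF : ∀ v : P 1 s, PA.IsPFEigenvector x v → T v = (spectralRadius ℂ x).toReal • v :=
    fun v hv => by rw [← Complex.coe_smul]; exact hv
  refine ⟨y, ⟨CStarAlgebra.nonneg_iff_eq_mul_star_self.1 hy0, isUnit_of_smul_one_le hε hy⟩, ?_,
    fun y₁ hy₁ hPF₁ => ?_, fun y' hy' => hirrT.exists_eq_smul hT hρ hε hy heig (hPF y' hy')⟩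
  · rw [PlanarAlg.CStarPlanarAlgebra.IsPFEigenvector, Complex.coe_smul]
    exact heig
  · have hy₁0 : 0 ≤ y₁ := CStarAlgebra.nonneg_iff_eq_mul_star_self.2 hy₁.1
    obtain ⟨c, rfl⟩ := hirrT.exists_eq_smul_of_isSelfAdjoint hT hρ hε hy heig
      (IsSelfAdjoint.of_nonneg hy₁0) (hPF y₁ hPF₁)
    refine ⟨c, ?_, (Complex.coe_smul c y).symm⟩
    -- If `c ≤ 0`, then `c • y` is both nonpositive and nonnegative, hence zero, which is not
    -- invertible here.
    by_contra hc
    have h0 : c • y = 0 := le_antisymm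
      (smul_nonpos_of_nonpos_of_nonneg (not_lt.1 hc) hy0) hy₁0
    exact not_isUnit_zero (h0 ▸ hy₁.2)
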